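/- Let $d\ge 2$, let $\mathbb S^d$ be the unit sphere of $\mathbb R^{d+1}$ with the Euclidean distance, $\sigma_d$ its normalized surface measure, and $C(x,t)=\{z\in\mathbb S^d: z\cdot x\ge t\}$ for $x\in\mathbb S^d$, $t\in[-1,1]$. Let $\mathcal H_1$ be the one-dimensional Hausdorff measure, and for $X\subset\mathbb S^d$ with $0<\mathcal H_1(X)<\infty$ define the one-dimensional spherical cap discrepancy $$D_{\mathbb L_2,1}^{\mathrm C}(X)=\left(\int_{-1}^1\int_{\mathbb S^d}\left|\frac{\mathcal H_1(X\cap C(x,t))}{\mathcal H_1(X)}-\sigma_d(C(x,t))\right|^2 d\sigma_d(x)\,dt\right)^{1/2}.$$ There exists a constant $c_{d,1}>0$, depending only on $d$, such that every rectifiable curve $\Gamma\subset\mathbb S^d$ (the image $\Gamma=\gamma([a,b])$ of a continuous map $\gamma:[a,b]\to\mathbb S^d$ of finite length) with length $\ell(\Gamma)\ge 1$ satisfies $$D_{\mathbb L_2,1}^{\mathrm C}(\Gamma)\ \ge\ c_{d,1}\,\ell(\Gamma)^{-\frac{d+1}{2(d-1)}} .$$ Here $\ell(\Gamma)$ may be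 read either as $\mathcal H_1(\Gamma)$ or as the arc length of $\gamma$ (the supremum of the lengths of inscribed polygons). The two agree for simple curves; for curves that retrace themselves they may differ, and the statement holds, with the same constant, under each reading. -/

import Mathlib

open MeasureTheory Set

noncomputable section

/-- The unit sphere `S^d` in the Euclidean space `ℝ^(d+1)`, with the Euclidean (chordal)
distance. -/
abbrev UnitSphere (d : ℕ) : Type :=
  Metric.sphere (0 : EuclideanSpace ℝ (Fin (d + 1))) 1

/-- The normalized (total mass one) uniform surface area measure `σ_d` on `S^d`. -/
def uniformSphere (d : ℕ) : Measure (UnitSphere d) :=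
  ((volume : Measure (EuclideanSpace ℝ (Fin (d + 1)))).toSphere univ)⁻¹ •
    (volume : Measure (EuclideanSpace ℝ (Fin (d + 1)))).toSphere

theorem uniformSphere_univ (d : ℕ) : uniformSphere d univ = 1 := by
  have h : (volume : Measure (EuclideanSpace ℝ (Fin (d + 1)))).toSphere univ ≠ 0 := by
    rw [Ne, Measure.measure_univ_eq_zero]
    exact Measure.toSphere_ne_zero _
  simpa [uniformSphere] using ENNReal.inv_mul_cancel h (measure_ne_top _ _)

instance (d : ℕ) : IsProbabilityMeasure (uniformSphere d) := ⟨uniformSphere_univ d⟩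

/-- The spherical cap `C(x, t) = {z ∈ S^d : z ⬝ x ≥ t}`. -/
def sphericalCap {d : ℕ} (x : UnitSphere d) (t : ℝ) : Set (UnitSphere d) :=
  {z | t ≤ inner ℝ (z : EuclideanSpace ℝ (Fin (d + 1))) (x : EuclideanSpace ℝ (Fin (d + 1)))}

/-- The `s`-dimensional spherical cap `L₂`-discrepancy of a set `X ⊆ S^d` (meant for sets with
`0 < μH[s] X < ∞`): the quadratic mean deviation of the normalized `s`-dimensional Hausdorff
measure on `X` from the uniform measure, over all spherical caps. -/
def capDiscrepancy {d : ℕ} (s : ℝ) (X : Set (UnitSphere d)) : ℝ :=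
  Real.sqrt (∫ t in (-1 : ℝ)..1, ∫ x : UnitSphere d,
    |(μH[s]).real (X ∩ sphericalCap x t) / (μH[s]).real X
      - (uniformSphere d).real (sphericalCap x t)| ^ 2 ∂(uniformSphere d))

/-- `γ` restricted to the compact interval `[a, b]` is a rectifiable curve in `S^d`: it is
continuous and the supremum of the lengths of inscribed polygons is finite. The curve may be closed
and it may intersect itself. -/
structure IsRectifiableCurve {d : ℕ} (γ : ℝ → UnitSphere d) (a b : ℝ) : Prop where
  le : a ≤ b
  continuousOn : ContinuousOn γ (Icc a b)
  boundedVariationOn : BoundedVariationOn γ (Icc a b)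

/-- The arc length of `γ` on `[a, b]`: the supremum of the lengths of inscribed polygons. -/
def arcLength {d : ℕ} (γ : ℝ → UnitSphere d) (a b : ℝ) : ℝ :=
  (eVariationOn γ (Icc a b)).toReal

end

/-! Write `ν` for normalized `μH[1]` on the curve and `σ` for the uniform measure. By Stolarsky's
invariance principle (`exists_integral_sq_sphericalCap_eq`) the squared discrepancy of `ν` is a
negative multiple of the energy of `ν - σ` for the kernel `|x - y|`. The distance is a superposition
over scales `r` of the functions `1 - exp(-(|x - y| / r)²)`, and constants have zero energy against
`ν - σ`, so the squared discrepancy is a positive multiple of the integral over `r > 0` of the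
Gaussian energies of `ν - σ` (`exists_integral_sq_sphericalCap_eq_gaussKernel`). Each of these is
nonnegative, since a Gaussian is an integral over the ambient space of products of narrower
Gaussians.

It therefore suffices to bound the energy below on one dyadic range of scales. If half of the sphere
lies at distance at least `ε` from the support of `ν`, testing `ν - σ` against `σ` restricted to
that half gives energy at least of order `r ^ d` for `r ≤ δ ε` (`exists_le_gaussian_energy`): at
such scales the test measure sees `σ` but hardly sees `ν`. Integrating over `r` between `δ ε / 2`
and `δ ε` gives order `ε ^ (d + 1)`.

A connected set with `μH[1]` at most `L` has packing numbers of order `L / ε`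
(`card_le_of_pairwise_lt_dist`), so its neighbourhood of width `ε` has measure of order `L ε ^ (d -
1)`. Taking `ε` to be a small multiple of `L ^ (-1 / (d - 1))` leaves half of the sphere free, and a
square root gives the exponent. -/

open scoped ENNReal Pointwise

/-! ### Polar coordinates, measures of balls and Gaussian integrals on the sphere. -/

/-- Integration in polar coordinates. -/
theorem lintegral_eq_lintegral_toSphere_volumeIoiPow {E : Type*} [NormedAddCommGroup E]
    [NormedSpace ℝ E] [FiniteDimensional ℝ E] [Nontrivial E] [MeasurableSpace E] [BorelSpace E]
    (μ : Measure E) [μ.IsAddHaarMeasure] {f : E → ℝ≥0∞} (hf : Measurable f) :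
    ∫⁻ w, f w ∂μ = ∫⁻ y : Metric.sphere (0 : E) 1, ∫⁻ ρ : Ioi (0 : ℝ), f ((ρ : ℝ) • (y : E))
      ∂(Measure.volumeIoiPow (Module.finrank ℝ E - 1)) ∂μ.toSphere := by
  have h1 : ∫⁻ w, f w ∂μ = ∫⁻ w : ({0}ᶜ : Set E), f w ∂(μ.comap (↑)) := by
    rw [lintegral_subtype_comap (measurableSet_singleton _).compl, restrict_compl_singleton]
  have hmeas : Measurable fun p : Metric.sphere (0 : E) 1 × Ioi (0 : ℝ) =>
      f ((p.2 : ℝ) • (p.1 : E)) :=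
    hf.comp ((measurable_subtype_coe.comp measurable_snd).smul
      (measurable_subtype_coe.comp measurable_fst))
  rw [h1, ← lintegral_prod _ hmeas.aemeasurable,
    ← (μ.measurePreserving_homeomorphUnitSphereProd).lintegral_comp hmeas]
  refine lintegral_congr fun w => ?_
  have hw : ‖(w : E)‖ ≠ 0 := norm_ne_zero_iff.2 w.2
  simp [homeomorphUnitSphereProd, smul_smul, mul_inv_cancel₀ hw]

theorem volumeIoiPow_apply_Ioo (n : ℕ) {a b : ℝ} (ha : 0 ≤ a) :
    Measure.volumeIoiPow n {ρ | (ρ : ℝ) ∈ Ioo a b} = ∫⁻ t in Ioo a b, ENNReal.ofReal (t ^ n) := by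
  have hm : MeasurableSet {ρ : Ioi (0 : ℝ) | (ρ : ℝ) ∈ Ioo a b} :=
    measurable_subtype_coe measurableSet_Ioo
  rw [Measure.volumeIoiPow, withDensity_apply _ hm,
    setLIntegral_subtype measurableSet_Ioi _ fun t : ℝ => ENNReal.ofReal (t ^ n)]
  congr 2
  ext t
  simp only [mem_image, mem_ofPred_eq, Subtype.exists, mem_Ioi]
  constructor
  · rintro ⟨t, _, h, rfl⟩
    exact h
  · intro h
    exact ⟨t, ha.trans_lt h.1, h, rfl⟩

theorem volumeIoiPow_Ioo_le (n : ℕ) {r : ℝ} (hr : r ≤ 1) :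
    Measure.volumeIoiPow n {ρ | (ρ : ℝ) ∈ Ioo (1 - r) (1 + r)} ≤ ENNReal.ofReal (2 ^ (n + 1) * r) := by
  rw [volumeIoiPow_apply_Ioo n (by linarith)]
  calc _ ≤ ∫⁻ t in Ioo (1 - r) (1 + r), ENNReal.ofReal (2 ^ n) := by
        refine setLIntegral_mono measurable_const fun t ht => ENNReal.ofReal_le_ofReal ?_
        exact pow_le_pow_left₀ (by linarith [ht.1]) (by linarith [ht.2]) n
    _ = ENNReal.ofReal (2 ^ (n + 1) * r) := by
        rw [setLIntegral_const, Real.volume_Ioo, ← ENNReal.ofReal_mul (by positivity)]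
        congr 1
        ring

theorem le_volumeIoiPow_Ioo (n : ℕ) (r : ℝ) :
    ENNReal.ofReal r ≤ Measure.volumeIoiPow n {ρ | (ρ : ℝ) ∈ Ioo 1 (1 + r)} := by
  rw [volumeIoiPow_apply_Ioo n zero_le_one]
  calc ENNReal.ofReal r = ∫⁻ t in Ioo 1 (1 + r), 1 := by simp
    _ ≤ _ := by
        refine setLIntegral_mono' measurableSet_Ioo fun t ht => ?_
        rw [← ENNReal.ofReal_one]
        exact ENNReal.ofReal_le_ofReal (one_le_pow₀ ht.1.le)

theorem sq_dist_smul {E : Type*} [NormedAddCommGroup E] [InnerProductSpace ℝ E] {x y : E}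
    (hx : ‖x‖ = 1) (hy : ‖y‖ = 1) (ρ : ℝ) :
    dist x (ρ • y) ^ 2 = (1 - ρ) ^ 2 + ρ * dist x y ^ 2 := by
  rw [dist_eq_norm, dist_eq_norm, norm_sub_sq_real, norm_sub_sq_real, norm_smul, inner_smul_right,
    hx, hy, Real.norm_eq_abs, mul_one, sq_abs]
  ring

/-- The total surface area of the sphere `S^d`. -/
noncomputable def sphereArea (d : ℕ) : ℝ :=
  (volume : Measure (EuclideanSpace ℝ (Fin (d + 1)))).toSphere.real univ

theorem sphereArea_pos (d : ℕ) : 0 < sphereArea d := by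
  rw [sphereArea, measureReal_def, ENNReal.toReal_pos_iff]
  refine ⟨?_, measure_lt_top _ _⟩
  rw [pos_iff_ne_zero, Ne, Measure.measure_univ_eq_zero]
  exact Measure.toSphere_ne_zero _

theorem toSphere_eq_smul_uniformSphere (d : ℕ) :
    (volume : Measure (EuclideanSpace ℝ (Fin (d + 1)))).toSphere =
      ENNReal.ofReal (sphereArea d) • uniformSphere d := by
  have h := sphereArea_pos d
  have h0 : (volume : Measure (EuclideanSpace ℝ (Fin (d + 1)))).toSphere univ ≠ 0 := by
    intro h0
    rw [sphereArea, measureReal_def, h0] at h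
    simp at h
  rw [sphereArea, ofReal_measureReal, uniformSphere, smul_smul,
    ENNReal.mul_inv_cancel h0 (measure_ne_top _ _), one_smul]

theorem lintegral_polar {d : ℕ} {f : EuclideanSpace ℝ (Fin (d + 1)) → ℝ≥0∞} (hf : Measurable f) :
    ∫⁻ w, f w = ENNReal.ofReal (sphereArea d) * ∫⁻ y : UnitSphere d, ∫⁻ ρ : Ioi (0 : ℝ),
      f ((ρ : ℝ) • (y : EuclideanSpace ℝ (Fin (d + 1)))) ∂(Measure.volumeIoiPow d)
        ∂(uniformSphere d) := by
  rw [lintegral_eq_lintegral_toSphere_volumeIoiPow volume hf, toSphere_eq_smul_uniformSphere,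
    lintegral_smul_measure]
  simp

theorem norm_unitSphere {d : ℕ} (x : UnitSphere d) :
    ‖(x : EuclideanSpace ℝ (Fin (d + 1)))‖ = 1 := by
  simp

/-- A Euclidean ball of radius `r` about `x`, of volume of order `r ^ (d + 1)`, lies in the polar
box over the spherical ball of radius `2 * r` with radii in `(1 - r, 1 + r)`. Dividing by the radial
factor, of order `r`, leaves `r ^ d`. -/
theorem exists_le_uniformSphere_ball (d : ℕ) :
    ∃ c : ℝ, 0 < c ∧ ∀ (x : UnitSphere d) (r : ℝ), 0 < r → r ≤ 1 →
      c * r ^ d ≤ (uniformSphere d).real (Metric.ball x r) := by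
  set B : ℝ := (volume : Measure (EuclideanSpace ℝ (Fin (d + 1)))).real (Metric.ball 0 1) with hB
  have hBpos : 0 < B :=
    ENNReal.toReal_pos (Metric.measure_ball_pos _ _ one_pos).ne' measure_ball_lt_top.ne
  have hA := sphereArea_pos d
  have key : ∀ (x : UnitSphere d) (r : ℝ), 0 < r → r ≤ 1 / 2 →
      B * r ^ (d + 1) ≤
        sphereArea d * ((uniformSphere d).real (Metric.ball x (2 * r)) * (2 ^ (d + 1) * r)) := by
    intro x r hr hr'
    have hmf : Measurable ((Metric.ball (x : EuclideanSpace ℝ (Fin (d + 1))) r).indicator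
        (1 : EuclideanSpace ℝ (Fin (d + 1)) → ℝ≥0∞)) :=
      measurable_one.indicator measurableSet_ball
    have h := lintegral_polar hmf
    have hI : MeasurableSet {ρ : Ioi (0 : ℝ) | (ρ : ℝ) ∈ Ioo (1 - r) (1 + r)} :=
      measurable_subtype_coe measurableSet_Ioo
    have hle : ∀ (y : UnitSphere d) (ρ : Ioi (0 : ℝ)),
        (Metric.ball (x : EuclideanSpace ℝ (Fin (d + 1))) r).indicator
          (1 : EuclideanSpace ℝ (Fin (d + 1)) → ℝ≥0∞) ((ρ : ℝ) • (y : EuclideanSpace ℝ (Fin (d + 1))))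
        ≤ (Metric.ball x (2 * r)).indicator 1 y *
          {ρ : Ioi (0 : ℝ) | (ρ : ℝ) ∈ Ioo (1 - r) (1 + r)}.indicator 1 ρ := by
      intro y ρ
      by_cases hy : ((ρ : ℝ) • (y : EuclideanSpace ℝ (Fin (d + 1)))) ∈
          Metric.ball (x : EuclideanSpace ℝ (Fin (d + 1))) r
      swap
      · simp [hy]
      rw [Metric.mem_ball, dist_comm] at hy
      have h1 := sq_dist_smul (norm_unitSphere x) (norm_unitSphere y) ρ
      have h2 : dist (x : EuclideanSpace ℝ (Fin (d + 1))) ((ρ : ℝ) • (y : _)) ^ 2 < r ^ 2 :=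
        pow_lt_pow_left₀ hy dist_nonneg two_ne_zero
      have hρ : 0 < (ρ : ℝ) := ρ.2
      have h3 : (1 - (ρ : ℝ)) ^ 2 < r ^ 2 := by
        have : 0 ≤ (ρ : ℝ) * dist (x : EuclideanSpace ℝ (Fin (d + 1))) y ^ 2 := by positivity
        linarith
      have h4 := abs_lt.1 (abs_lt_of_sq_lt_sq h3 hr.le)
      -- Since `r ≤ 1 / 2`, the radius `ρ` exceeds `1 / 2`, so `ρ * dist ^ 2 < r ^ 2` gives `dist ^
      -- 2 < 2 * r ^ 2`.
      have h5 : dist x y < 2 * r := by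
        refine lt_of_pow_lt_pow_left₀ 2 (by positivity) ?_
        rw [Subtype.dist_eq]
        nlinarith [sq_nonneg (1 - (ρ : ℝ)), sq_nonneg (dist (x : EuclideanSpace ℝ (Fin (d + 1))) y)]
      have h6 : y ∈ Metric.ball x (2 * r) := by rwa [Metric.mem_ball, dist_comm]
      have h7 : ρ ∈ {ρ : Ioi (0 : ℝ) | (ρ : ℝ) ∈ Ioo (1 - r) (1 + r)} :=
        ⟨by linarith, by linarith⟩
      rw [indicator_of_mem h6, indicator_of_mem h7]
      simpa using indicator_le_self' (f := (1 : EuclideanSpace ℝ (Fin (d + 1)) → ℝ≥0∞))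
        (fun _ _ => zero_le) _
    have h8 : ENNReal.ofReal (B * r ^ (d + 1)) ≤ ENNReal.ofReal (sphereArea d *
        ((uniformSphere d).real (Metric.ball x (2 * r)) * (2 ^ (d + 1) * r))) := by
      have hl : ∫⁻ w, (Metric.ball (x : EuclideanSpace ℝ (Fin (d + 1))) r).indicator
          (1 : EuclideanSpace ℝ (Fin (d + 1)) → ℝ≥0∞) w = ENNReal.ofReal (B * r ^ (d + 1)) := by
        rw [lintegral_indicator_one measurableSet_ball, Measure.addHaar_ball _ _ hr.le, mul_comm B,
          ENNReal.ofReal_mul (by positivity), hB, ofReal_measureReal]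
        simp
      rw [← hl, h, ENNReal.ofReal_mul hA.le]
      gcongr
      calc _ ≤ ∫⁻ y : UnitSphere d, ∫⁻ ρ : Ioi (0 : ℝ), (Metric.ball x (2 * r)).indicator 1 y *
          {ρ : Ioi (0 : ℝ) | (ρ : ℝ) ∈ Ioo (1 - r) (1 + r)}.indicator 1 ρ
            ∂(Measure.volumeIoiPow d) ∂(uniformSphere d) :=
            lintegral_mono fun y => lintegral_mono fun ρ => hle y ρ
        _ = uniformSphere d (Metric.ball x (2 * r)) *
            Measure.volumeIoiPow d {ρ | (ρ : ℝ) ∈ Ioo (1 - r) (1 + r)} := by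
            simp_rw [lintegral_const_mul _ (measurable_one.indicator hI),
              lintegral_indicator_one hI]
            rw [lintegral_mul_const _ (measurable_one.indicator measurableSet_ball),
              lintegral_indicator_one measurableSet_ball]
        _ ≤ _ := by
            rw [ENNReal.ofReal_mul measureReal_nonneg, ofReal_measureReal]
            gcongr
            exact volumeIoiPow_Ioo_le d (by linarith)
    exact (ENNReal.ofReal_le_ofReal_iff (by positivity)).1 h8
  refine ⟨B / (sphereArea d * 2 ^ (2 * d + 1)), by positivity, fun x r hr hr' => ?_⟩
  have h := key x (r / 2) (by positivity) (by linarith)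
  rw [mul_div_cancel₀ r two_ne_zero] at h
  rw [div_mul_eq_mul_div, div_le_iff₀ (by positivity)]
  have h2 : (2 : ℝ) ^ (2 * d + 1) = 2 ^ d * 2 ^ (d + 1) := by rw [← pow_add]; congr 1; omega
  have h3 : B * r ^ d * (r / 2) ≤ (uniformSphere d).real (Metric.ball x r) *
      (sphereArea d * 2 ^ (2 * d + 1)) * (r / 2) := by
    rw [h2]
    calc B * r ^ d * (r / 2) = 2 ^ d * (B * (r / 2) ^ (d + 1)) := by
          rw [div_pow, pow_succ, pow_succ]; field_simp
      _ ≤ 2 ^ d * (sphereArea d * ((uniformSphere d).real (Metric.ball x r) *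
          (2 ^ (d + 1) * (r / 2)))) := by gcongr
      _ = _ := by ring
  exact le_of_mul_le_mul_right h3 (by positivity)

/-- The ambient Gaussian of width `r` centred at `x` has integral of order `r ^ (d + 1)`, and on the
shell `1 < ρ < 1 + r` it dominates a constant times the Gaussian of the spherical variable. The
radial measure of the shell is at least `r`. -/
theorem exists_integral_gaussian_le (d : ℕ) :
    ∃ C : ℝ, 0 < C ∧ ∀ (x : UnitSphere d) (r : ℝ), 0 < r →
      ∫ y, Real.exp (-(dist x y / r) ^ 2) ∂(uniformSphere d) ≤ C * r ^ d := by
  have hA := sphereArea_pos d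
  set G : ℝ := ∫ w : EuclideanSpace ℝ (Fin (d + 1)), Real.exp (-(1 / 2) * ‖w‖ ^ 2) with hG
  have hGval : G = (Real.pi / (1 / 2)) ^ ((Module.finrank ℝ (EuclideanSpace ℝ (Fin (d + 1))) : ℝ) / 2) :=
    GaussianFourier.integral_rexp_neg_mul_sq_norm (by norm_num)
  have hGpos : 0 < G := by rw [hGval]; positivity
  refine ⟨G * Real.exp 1 / sphereArea d, by positivity, fun x r hr => ?_⟩
  -- The factor `1 / 2` pays for `(s + r)² ≤ 2 s² + 2 r²`, which separates the spherical distance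
  -- `s` from the radial displacement.
  set f : EuclideanSpace ℝ (Fin (d + 1)) → ℝ := fun w => Real.exp (-(1 / 2) * ‖r⁻¹ • (w - x)‖ ^ 2)
    with hf
  have hfc : Continuous f := by fun_prop
  have hfint : ∫ w, f w = r ^ (d + 1) * G := by
    have h1 := integral_sub_right_eq_self
      (fun w : EuclideanSpace ℝ (Fin (d + 1)) => Real.exp (-(1 / 2) * ‖r⁻¹ • w‖ ^ 2)) (μ := volume) (x : EuclideanSpace ℝ (Fin (d + 1)))
    rw [hf, h1, Measure.integral_comp_smul volume
      (fun w : EuclideanSpace ℝ (Fin (d + 1)) => Real.exp (-(1 / 2) * ‖w‖ ^ 2))]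
    simp [abs_of_pos hr, hG]
  have hfi : Integrable f := by
    refine Integrable.of_integral_ne_zero ?_
    rw [hfint]
    positivity
  have hpol := lintegral_polar (d := d) (f := fun w => ENNReal.ofReal (f w))
    (hfc.measurable.ennreal_ofReal)
  rw [← ofReal_integral_eq_lintegral_ofReal hfi (ae_of_all _ fun w => (Real.exp_pos _).le),
    hfint] at hpol
  have hI : MeasurableSet {ρ : Ioi (0 : ℝ) | (ρ : ℝ) ∈ Ioo 1 (1 + r)} :=
    measurable_subtype_coe measurableSet_Ioo
  have hlow : ∀ (y : UnitSphere d) (ρ : Ioi (0 : ℝ)),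
      ENNReal.ofReal (Real.exp (-(dist x y / r) ^ 2) * Real.exp (-1)) *
        {ρ : Ioi (0 : ℝ) | (ρ : ℝ) ∈ Ioo 1 (1 + r)}.indicator 1 ρ ≤
      ENNReal.ofReal (f ((ρ : ℝ) • (y : EuclideanSpace ℝ (Fin (d + 1))))) := by
    intro y ρ
    by_cases hρ : ρ ∈ {ρ : Ioi (0 : ℝ) | (ρ : ℝ) ∈ Ioo 1 (1 + r)}
    swap
    · rw [indicator_of_notMem hρ, mul_zero]
      exact zero_le
    rw [indicator_of_mem hρ, Pi.one_apply, mul_one, ← Real.exp_add]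
    refine ENNReal.ofReal_le_ofReal (Real.exp_le_exp.2 ?_)
    have h1 : ‖r⁻¹ • ((ρ : ℝ) • (y : EuclideanSpace ℝ (Fin (d + 1))) - x)‖ ^ 2 =
        dist (x : EuclideanSpace ℝ (Fin (d + 1))) ((ρ : ℝ) • (y : _)) ^ 2 / r ^ 2 := by
      rw [norm_smul, norm_inv, Real.norm_eq_abs, abs_of_pos hr, ← dist_eq_norm, dist_comm]
      field_simp
    have h2 : dist (x : EuclideanSpace ℝ (Fin (d + 1))) ((ρ : ℝ) • (y : _)) ≤
        dist x y + r := by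
      have h3 : dist (y : EuclideanSpace ℝ (Fin (d + 1))) ((ρ : ℝ) • (y : _)) ≤ r := by
        have : (y : EuclideanSpace ℝ (Fin (d + 1))) - (ρ : ℝ) • (y : _) =
            (1 - (ρ : ℝ)) • (y : EuclideanSpace ℝ (Fin (d + 1))) := by rw [sub_smul, one_smul]
        rw [dist_eq_norm, this, norm_smul, norm_unitSphere, mul_one, Real.norm_eq_abs, abs_le]
        exact ⟨by linarith [hρ.2], by linarith [hρ.1]⟩
      exact (dist_triangle _ (y : EuclideanSpace ℝ (Fin (d + 1))) _).trans (by gcongr; rfl)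
    have h4 : dist (x : EuclideanSpace ℝ (Fin (d + 1))) ((ρ : ℝ) • (y : _)) ^ 2 ≤
        2 * dist x y ^ 2 + 2 * r ^ 2 := by
      nlinarith [pow_le_pow_left₀ dist_nonneg h2 2, sq_nonneg (dist x y - r)]
    rw [h1, div_pow]
    have h5 : dist (x : EuclideanSpace ℝ (Fin (d + 1))) ((ρ : ℝ) • (y : _)) ^ 2 / r ^ 2 ≤
        2 * (dist x y ^ 2 / r ^ 2) + 2 := by
      rw [div_le_iff₀ (by positivity)]
      field_simp
      linarith
    linarith
  have hint : Integrable (fun y => Real.exp (-(dist x y / r) ^ 2)) (uniformSphere d) := by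
    refine Integrable.of_bound (Continuous.aestronglyMeasurable (by fun_prop)) 1
      (ae_of_all _ fun y => ?_)
    rw [Real.norm_eq_abs, Real.abs_exp, Real.exp_le_one_iff]
    nlinarith [sq_nonneg (dist x y / r)]
  have h9 : ENNReal.ofReal (sphereArea d *
      ((∫ y, Real.exp (-(dist x y / r) ^ 2) ∂(uniformSphere d)) * Real.exp (-1) * r)) ≤
      ENNReal.ofReal (r ^ (d + 1) * G) := by
    rw [hpol, ENNReal.ofReal_mul hA.le]
    gcongr
    refine le_trans ?_ (lintegral_mono fun y => lintegral_mono fun ρ => hlow y ρ)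
    simp_rw [lintegral_const_mul _ (measurable_one.indicator hI), lintegral_indicator_one hI]
    rw [lintegral_mul_const _ (Measurable.ennreal_ofReal (Continuous.measurable (by fun_prop))),
      ← ofReal_integral_eq_lintegral_ofReal (hint.mul_const _)
        (ae_of_all _ fun y => by positivity), integral_mul_const,
      ENNReal.ofReal_mul (by positivity)]
    gcongr
    exact le_volumeIoiPow_Ioo d r
  have h10 := (ENNReal.ofReal_le_ofReal_iff (by positivity)).1 h9
  rw [Real.exp_neg] at h10
  have h11 : (∫ y, Real.exp (-(dist x y / r) ^ 2) ∂(uniformSphere d)) *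
      (sphereArea d * r) ≤ G * Real.exp 1 * r ^ d * r := by
    have := mul_le_mul_of_nonneg_right h10 (Real.exp_pos 1).le
    calc _ = sphereArea d * ((∫ y, Real.exp (-(dist x y / r) ^ 2) ∂(uniformSphere d)) *
          (Real.exp 1)⁻¹ * r) * Real.exp 1 := by field_simp
      _ ≤ _ := this
      _ = _ := by ring
  rw [div_mul_eq_mul_div, le_div_iff₀ hA]
  refine le_of_mul_le_mul_right ?_ hr
  linarith

/-! ### Rotation invariance and the mean of `|⟨v, x⟩|`. -/

theorem exists_linearIsometryEquiv_map_eq {E : Type*} [NormedAddCommGroup E] [InnerProductSpace ℝ E]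
    {u v : E} (h : ‖u‖ = ‖v‖) : ∃ R : E ≃ₗᵢ[ℝ] E, R u = v :=
  ⟨(ℝ ∙ (u - v))ᗮ.reflection, Submodule.reflection_sub h⟩

/-- The action of a linear isometry on the unit sphere. -/
noncomputable def sphereMap {d : ℕ}
    (R : EuclideanSpace ℝ (Fin (d + 1)) ≃ₗᵢ[ℝ] EuclideanSpace ℝ (Fin (d + 1))) (x : UnitSphere d) :
    UnitSphere d :=
  ⟨R x, by simp⟩

theorem measurePreserving_sphereMap {d : ℕ}
    (R : EuclideanSpace ℝ (Fin (d + 1)) ≃ₗᵢ[ℝ] EuclideanSpace ℝ (Fin (d + 1))) :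
    MeasurePreserving (sphereMap R) (uniformSphere d) (uniformSphere d) := by
  have hm : Measurable (sphereMap R) :=
    (Continuous.subtype_mk (R.continuous.comp continuous_subtype_val) _).measurable
  refine ⟨hm, ?_⟩
  rw [uniformSphere, Measure.map_smul]
  congr 1
  ext s hs
  rw [Measure.map_apply hm hs, Measure.toSphere_apply' _ (hm hs), Measure.toSphere_apply' _ hs]
  congr 1
  -- `toSphere` is given by volumes of cones, and `R` commutes with forming cones.
  have : Ioo (0 : ℝ) 1 • (Subtype.val '' (sphereMap R ⁻¹' s)) =
      R ⁻¹' (Ioo (0 : ℝ) 1 • (Subtype.val '' s)) := by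
    ext w
    simp only [mem_smul, mem_image, mem_preimage]
    constructor
    · rintro ⟨t, ht, _, ⟨y, hy, rfl⟩, rfl⟩
      exact ⟨t, ht, _, ⟨_, hy, rfl⟩, by simp [sphereMap]⟩
    · rintro ⟨t, ht, _, ⟨y, hy, rfl⟩, h⟩
      refine ⟨t, ht, _, ⟨sphereMap R.symm y, ?_, rfl⟩, ?_⟩
      · have : sphereMap R (sphereMap R.symm y) = y := Subtype.ext (by simp [sphereMap])
        rwa [this]
      · apply R.injective
        simpa [sphereMap] using h
  rw [this]
  exact R.measurePreserving.measure_preimage_equiv (f := R.toMeasurableEquiv) _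

/-- By rotation invariance and homogeneity the integral depends on `v` only through its norm. The
constant is positive because `uniformSphere d` charges every nonempty open set. -/
theorem exists_integral_abs_inner (d : ℕ) :
    ∃ c : ℝ, 0 < c ∧ ∀ v : EuclideanSpace ℝ (Fin (d + 1)),
      ∫ x : UnitSphere d, |inner ℝ v (x : EuclideanSpace ℝ (Fin (d + 1)))| ∂(uniformSphere d)
        = c * ‖v‖ := by
  obtain ⟨e⟩ : Nonempty (UnitSphere d) :=
    (NormedSpace.sphere_nonempty.2 zero_le_one).to_subtype
  have hrot : ∀ (v : EuclideanSpace ℝ (Fin (d + 1)))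
      (R : EuclideanSpace ℝ (Fin (d + 1)) ≃ₗᵢ[ℝ] EuclideanSpace ℝ (Fin (d + 1))),
      ∫ x : UnitSphere d, |inner ℝ (R v) (x : EuclideanSpace ℝ (Fin (d + 1)))| ∂(uniformSphere d) =
      ∫ x : UnitSphere d, |inner ℝ v (x : EuclideanSpace ℝ (Fin (d + 1)))| ∂(uniformSphere d) := by
    intro v R
    have hmp := measurePreserving_sphereMap R
    have hc : Continuous fun x : UnitSphere d =>
        |inner ℝ (R v) (x : EuclideanSpace ℝ (Fin (d + 1)))| := by fun_prop
    conv_lhs => rw [← hmp.map_eq]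
    rw [integral_map hmp.aemeasurable hc.aestronglyMeasurable]
    simp [sphereMap]
  refine ⟨∫ x : UnitSphere d, |inner ℝ (e : EuclideanSpace ℝ (Fin (d + 1))) (x : _)|
    ∂(uniformSphere d), ?_, fun v => ?_⟩
  · have hc : Continuous fun x : UnitSphere d =>
        |inner ℝ (e : EuclideanSpace ℝ (Fin (d + 1))) (x : EuclideanSpace ℝ (Fin (d + 1)))| := by
      fun_prop
    have : (uniformSphere d).IsOpenPosMeasure := by
      constructor
      rintro U hU ⟨x, hx⟩ h0
      obtain ⟨c, hc, h⟩ := exists_le_uniformSphere_ball d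
      obtain ⟨ε, hε, hs⟩ := Metric.isOpen_iff.1 hU x hx
      have h1 := h x (min ε 1) (by positivity) (min_le_right _ _)
      have h2 : uniformSphere d (Metric.ball x (min ε 1)) = 0 :=
        measure_mono_null ((Metric.ball_subset_ball (min_le_left _ _)).trans hs) h0
      rw [measureReal_def, h2, ENNReal.toReal_zero] at h1
      have : 0 < c * (min ε 1) ^ d := by positivity
      linarith
    refine hc.integral_pos_of_hasCompactSupport_nonneg_nonzero
      (HasCompactSupport.of_compactSpace _) (fun x => abs_nonneg _) (x := e) ?_
    simp
  · have h : ‖‖v‖ • (e : EuclideanSpace ℝ (Fin (d + 1)))‖ = ‖v‖ := by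
      rw [norm_smul, norm_unitSphere, norm_norm, mul_one]
    obtain ⟨R, hR⟩ := exists_linearIsometryEquiv_map_eq h
    rw [← hR, hrot, hR, mul_comm, ← integral_const_mul]
    refine integral_congr_ae (ae_of_all _ fun x => ?_)
    simp [inner_smul_left, abs_mul]

/-! ### Stolarsky's invariance principle. -/

/-- Fubini for a product of two averages. Only one factor needs an integrable majorant, so `m` may
be infinite: the same lemma serves the cap parameters and Lebesgue measure on the ambient space. -/
theorem integral_mul_integral_eq {A B Ω : Type*} [MeasurableSpace A] [MeasurableSpace B]
    [MeasurableSpace Ω] {α : Measure A} {β : Measure B} {m : Measure Ω} [IsFiniteMeasure α]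
    [IsFiniteMeasure β] [SFinite m] {F : A → Ω → ℝ} {G : B → Ω → ℝ}
    (hF : Measurable (Function.uncurry F)) (hG : Measurable (Function.uncurry G)) {M : Ω → ℝ}
    (hM : Integrable M m) {C : ℝ} (hFM : ∀ a ω, |F a ω| ≤ M ω) (hGC : ∀ b ω, |G b ω| ≤ C) :
    Integrable (fun ω => (∫ a, F a ω ∂α) * ∫ b, G b ω ∂β) m ∧
    ∫ ω, (∫ a, F a ω ∂α) * (∫ b, G b ω ∂β) ∂m =
      ∫ p, ∫ ω, F p.1 ω * G p.2 ω ∂m ∂(α.prod β) := by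
  have hm : Measurable (fun q : (A × B) × Ω => F q.1.1 q.2 * G q.1.2 q.2) :=
    (hF.comp ((measurable_fst.comp measurable_fst).prodMk measurable_snd)).mul
      (hG.comp ((measurable_snd.comp measurable_fst).prodMk measurable_snd))
  have hI : Integrable (fun q : (A × B) × Ω => F q.1.1 q.2 * G q.1.2 q.2) ((α.prod β).prod m) := by
    refine ((hM.mul_const C).comp_snd (α.prod β)).mono' hm.aestronglyMeasurable
      (ae_of_all _ fun q => ?_)
    rw [Real.norm_eq_abs, abs_mul]
    exact mul_le_mul (hFM _ _) (hGC _ _) (abs_nonneg _) ((abs_nonneg _).trans (hFM q.1.1 _))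
  constructor
  · simp_rw [← integral_prod_mul]
    exact hI.integral_prod_right
  · simp_rw [← integral_prod_mul]
    exact (integral_integral_swap hI).symm

/-- The mixed second difference of a kernel. -/
def secondDiff {X : Type*} (K : X → X → ℝ) (p q : X × X) : ℝ :=
  K p.1 q.1 - K p.1 q.2 - K p.2 q.1 + K p.2 q.2

theorem integral_sub_sub_add {X : Type*} [MeasurableSpace X] {μ : Measure X} {f g h k : X → ℝ}
    (hf : Integrable f μ) (hg : Integrable g μ) (hh : Integrable h μ) (hk : Integrable k μ) :
    ∫ x, (f x - g x - h x + k x) ∂μ =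
      ∫ x, f x ∂μ - ∫ x, g x ∂μ - ∫ x, h x ∂μ + ∫ x, k x ∂μ := by
  rw [← integral_sub hf hg, ← integral_sub (f := fun x => f x - g x) (hf.sub hg) hh,
    ← integral_add (f := fun x => f x - g x - h x) ((hf.sub hg).sub hh) hk]

theorem integral_Iic_mul_Iic {a b : ℝ} (ha : a ∈ Icc (-1 : ℝ) 1) (hb : b ∈ Icc (-1 : ℝ) 1) :
    ∫ t in Ioc (-1 : ℝ) 1, (Iic a).indicator 1 t * (Iic b).indicator 1 t = min a b + 1 := by
  have h : ∀ t : ℝ, (Iic a).indicator (1 : ℝ → ℝ) t * (Iic b).indicator 1 t =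
      (Iic (min a b)).indicator 1 t := by
    intro t
    rw [← Iic_inter_Iic, inter_indicator_one, Pi.mul_apply]
  simp_rw [h]
  rw [integral_indicator_one measurableSet_Iic, measureReal_restrict_apply measurableSet_Iic,
    inter_comm, Ioc_inter_Iic, min_eq_right (min_le_of_left_le ha.2), Real.volume_real_Ioc_of_le]
  · ring
  · exact le_min ha.1 hb.1

theorem min_eq_half_sub_abs (a b : ℝ) : min a b = (a + b) / 2 - |a - b| / 2 := by
  rcases le_total a b with h | h
  · rw [min_eq_left h, abs_of_nonpos (by linarith)]; ring
  · rw [min_eq_right h, abs_of_nonneg (by linarith)]; ring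

/-- Each product of indicators integrates to a minimum plus one; in `min a b = (a + b) / 2 - |a - b|
/ 2` the linear part cancels in a mixed second difference. -/
theorem integral_Iic_sub_mul_Iic_sub {a a' b b' : ℝ} (ha : a ∈ Icc (-1 : ℝ) 1)
    (ha' : a' ∈ Icc (-1 : ℝ) 1) (hb : b ∈ Icc (-1 : ℝ) 1) (hb' : b' ∈ Icc (-1 : ℝ) 1) :
    ∫ t in Ioc (-1 : ℝ) 1, ((Iic a).indicator 1 t - (Iic a').indicator 1 t) *
      ((Iic b).indicator 1 t - (Iic b').indicator 1 t) =
    -(1 / 2) * (|a - b| - |a - b'| - |a' - b| + |a' - b'|) := by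
  have hi : ∀ u v : ℝ, IntegrableOn
      (fun t => (Iic u).indicator (1 : ℝ → ℝ) t * (Iic v).indicator 1 t) (Ioc (-1 : ℝ) 1) := by
    intro u v
    have h : (fun t => (Iic u).indicator (1 : ℝ → ℝ) t * (Iic v).indicator 1 t) =
        (Iic u ∩ Iic v).indicator 1 := by
      rw [inter_indicator_one]; rfl
    rw [h]
    exact (integrable_const (1 : ℝ)).indicator (measurableSet_Iic.inter measurableSet_Iic)
  have h : ∀ t : ℝ, ((Iic a).indicator (1 : ℝ → ℝ) t - (Iic a').indicator 1 t) *
      ((Iic b).indicator 1 t - (Iic b').indicator 1 t) =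
      (Iic a).indicator 1 t * (Iic b).indicator 1 t - (Iic a).indicator 1 t * (Iic b').indicator 1 t
      - (Iic a').indicator 1 t * (Iic b).indicator 1 t
      + (Iic a').indicator 1 t * (Iic b').indicator 1 t := fun t => by ring
  simp_rw [h]
  rw [integral_sub_sub_add (hi _ _) (hi _ _) (hi _ _) (hi _ _),
    integral_Iic_mul_Iic ha hb, integral_Iic_mul_Iic ha hb', integral_Iic_mul_Iic ha' hb,
    integral_Iic_mul_Iic ha' hb']
  simp only [min_eq_half_sub_abs]
  ring

theorem inner_unitSphere_mem_Icc {d : ℕ} (z x : UnitSphere d) :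
    inner ℝ (z : EuclideanSpace ℝ (Fin (d + 1))) (x : EuclideanSpace ℝ (Fin (d + 1))) ∈
      Icc (-1 : ℝ) 1 := by
  have := abs_real_inner_le_norm (z : EuclideanSpace ℝ (Fin (d + 1))) x
  rw [norm_unitSphere, norm_unitSphere, one_mul] at this
  exact abs_le.1 this

theorem isClosed_sphericalCap {d : ℕ} (x : UnitSphere d) (t : ℝ) : IsClosed (sphericalCap x t) :=
  isClosed_le (by fun_prop) (by fun_prop)

theorem measurable_uncurry_sub {A Ω : Type*} [MeasurableSpace A] [MeasurableSpace Ω]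
    {f : A → Ω → ℝ} (hf : Measurable (Function.uncurry f)) :
    Measurable (Function.uncurry fun (p : A × A) ω => f p.1 ω - f p.2 ω) :=
  (hf.comp ((measurable_fst.comp measurable_fst).prodMk measurable_snd)).sub
    (hf.comp ((measurable_snd.comp measurable_fst).prodMk measurable_snd))

/-- The indicator of the cap `C(x, t)` at the point `z`, as a function of `z` and `(t, x)`. -/
noncomputable def capInd {d : ℕ} (z : UnitSphere d) (ω : ℝ × UnitSphere d) : ℝ :=
  (Iic (inner ℝ (z : EuclideanSpace ℝ (Fin (d + 1)))
    (ω.2 : EuclideanSpace ℝ (Fin (d + 1))))).indicator 1 ω.1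

/-- The difference of the indicators of the cap `C(x, t)` at two points `z, z'`, as a function of
`(z, z')` and `(t, x)`. -/
noncomputable def capDiff {d : ℕ} (p : UnitSphere d × UnitSphere d) (ω : ℝ × UnitSphere d) : ℝ :=
  capInd p.1 ω - capInd p.2 ω

theorem capInd_eq_indicator {d : ℕ} (x z : UnitSphere d) (t : ℝ) :
    capInd z (t, x) = (sphericalCap x t).indicator 1 z := by
  simp [capInd, indicator_apply, sphericalCap]

theorem abs_capDiff_le {d : ℕ} (p : UnitSphere d × UnitSphere d) (ω : ℝ × UnitSphere d) :
    |capDiff p ω| ≤ 1 := by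
  simp only [capDiff, capInd, indicator_apply, Pi.one_apply]
  split_ifs <;> norm_num

theorem measurable_capInd (d : ℕ) : Measurable (Function.uncurry (capInd (d := d))) := by
  have hs : MeasurableSet {q : (UnitSphere d) × (ℝ × UnitSphere d) |
      q.2.1 ≤ inner ℝ (q.1 : EuclideanSpace ℝ (Fin (d + 1)))
        (q.2.2 : EuclideanSpace ℝ (Fin (d + 1)))} :=
    (isClosed_le (by fun_prop) (by fun_prop)).measurableSet
  convert (measurable_one (α := ℝ)).indicator hs using 1
  ext q
  simp [Function.uncurry, capInd, indicator_apply]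

theorem measurable_capDiff (d : ℕ) : Measurable (Function.uncurry (capDiff (d := d))) :=
  measurable_uncurry_sub (measurable_capInd d)

/-- Integrating differences over pairs drawn from `ν.prod σ` plays the role of integrating against
the signed measure `ν - σ`. -/
theorem integral_capDiff {d : ℕ} (ν σ : Measure (UnitSphere d)) [IsProbabilityMeasure ν]
    [IsProbabilityMeasure σ] (t : ℝ) (x : UnitSphere d) :
    ∫ p, capDiff p (t, x) ∂(ν.prod σ) = ν.real (sphericalCap x t) - σ.real (sphericalCap x t) := by
  have h1 := (isClosed_sphericalCap x t).measurableSet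
  have hi : ∀ (ρ : Measure (UnitSphere d)) [IsProbabilityMeasure ρ],
      Integrable (fun z => (sphericalCap x t).indicator (1 : UnitSphere d → ℝ) z) ρ := fun ρ _ =>
    (integrable_const (1 : ℝ)).indicator h1
  simp only [capDiff, capInd_eq_indicator]
  rw [integral_sub ((hi ν).comp_fst _) ((hi σ).comp_snd _),
    integral_fun_fst (fun z => (sphericalCap x t).indicator (1 : UnitSphere d → ℝ) z),
    integral_fun_snd (fun z => (sphericalCap x t).indicator (1 : UnitSphere d → ℝ) z),
    integral_indicator_one h1, integral_indicator_one h1]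
  simp

theorem integral_capDiff_mul_capDiff {d : ℕ} {c : ℝ}
    (hc : ∀ v : EuclideanSpace ℝ (Fin (d + 1)),
      ∫ x : UnitSphere d, |inner ℝ v (x : EuclideanSpace ℝ (Fin (d + 1)))| ∂(uniformSphere d)
        = c * ‖v‖) (p q : UnitSphere d × UnitSphere d) :
    ∫ ω, capDiff p ω * capDiff q ω
      ∂((volume.restrict (Ioc (-1 : ℝ) 1)).prod (uniformSphere d)) =
        -(c / 2) * secondDiff dist p q := by
  have hmeas := measurable_capDiff d
  have hI : Integrable (fun ω => capDiff p ω * capDiff q ω)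
      ((volume.restrict (Ioc (-1 : ℝ) 1)).prod (uniformSphere d)) := by
    refine Integrable.of_bound (Measurable.aestronglyMeasurable ?_) 1 (ae_of_all _ fun ω => ?_)
    · exact hmeas.of_uncurry_left.mul hmeas.of_uncurry_left
    · rw [Real.norm_eq_abs, abs_mul]
      exact mul_le_one₀ (abs_capDiff_le _ _) (abs_nonneg _) (abs_capDiff_le _ _)
  have hx : ∀ z w : UnitSphere d, Integrable (fun x : UnitSphere d =>
      |inner ℝ (z : EuclideanSpace ℝ (Fin (d + 1))) (x : EuclideanSpace ℝ (Fin (d + 1))) -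
        inner ℝ (w : EuclideanSpace ℝ (Fin (d + 1))) (x : EuclideanSpace ℝ (Fin (d + 1)))|)
        (uniformSphere d) := by
    intro z w
    refine Integrable.of_bound (Continuous.aestronglyMeasurable (by fun_prop)) 2
      (ae_of_all _ fun x => ?_)
    have h1 := inner_unitSphere_mem_Icc z x
    have h2 := inner_unitSphere_mem_Icc w x
    rw [Real.norm_eq_abs, abs_abs, abs_le]
    exact ⟨by linarith [h1.1, h2.2], by linarith [h1.2, h2.1]⟩
  have hd : ∀ z w : UnitSphere d, ∫ x : UnitSphere d,
      |inner ℝ (z : EuclideanSpace ℝ (Fin (d + 1))) (x : EuclideanSpace ℝ (Fin (d + 1))) -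
        inner ℝ (w : EuclideanSpace ℝ (Fin (d + 1))) (x : EuclideanSpace ℝ (Fin (d + 1)))|
        ∂(uniformSphere d) = c * dist z w := by
    intro z w
    simp_rw [← inner_sub_left]
    rw [hc, Subtype.dist_eq, dist_eq_norm]
  have hin : ∀ x : UnitSphere d, ∫ t in Ioc (-1 : ℝ) 1, capDiff p (t, x) * capDiff q (t, x) = _ :=
    fun x => integral_Iic_sub_mul_Iic_sub (inner_unitSphere_mem_Icc p.1 x)
      (inner_unitSphere_mem_Icc p.2 x) (inner_unitSphere_mem_Icc q.1 x)
      (inner_unitSphere_mem_Icc q.2 x)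
  rw [integral_prod_symm _ hI, integral_congr_ae (ae_of_all _ hin), integral_const_mul,
    integral_sub_sub_add (hx _ _) (hx _ _) (hx _ _) (hx _ _), hd, hd, hd, hd, secondDiff]
  ring

/-- A form of Stolarsky's invariance principle: the cap discrepancy of a probability measure in
terms of the sum of distances. -/
theorem exists_integral_sq_sphericalCap_eq (d : ℕ) :
    ∃ c : ℝ, 0 < c ∧ ∀ (ν : Measure (UnitSphere d)) [IsProbabilityMeasure ν],
      ∫ t in (-1 : ℝ)..1, ∫ x : UnitSphere d,
        (ν.real (sphericalCap x t) - (uniformSphere d).real (sphericalCap x t)) ^ 2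
          ∂(uniformSphere d) =
      -c * ∫ pq, secondDiff dist pq.1 pq.2
        ∂((ν.prod (uniformSphere d)).prod (ν.prod (uniformSphere d))) := by
  obtain ⟨c, hc, hcv⟩ := exists_integral_abs_inner d
  refine ⟨c / 2, by positivity, fun ν _ => ?_⟩
  have h := integral_mul_integral_eq (F := capDiff (d := d)) (G := capDiff (d := d))
    (α := ν.prod (uniformSphere d)) (β := ν.prod (uniformSphere d))
    (m := (volume.restrict (Ioc (-1 : ℝ) 1)).prod (uniformSphere d))
    (measurable_capDiff d) (measurable_capDiff d) (M := fun _ => 1) (integrable_const (1 : ℝ))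
    (C := 1) abs_capDiff_le abs_capDiff_le
  have hE := h.2
  rw [integral_prod _ h.1] at hE
  rw [intervalIntegral.integral_of_le (by norm_num), ← integral_const_mul]
  simp_rw [integral_capDiff_mul_capDiff hcv] at hE
  rw [← hE]
  simp_rw [integral_capDiff, sq]

/-! ### The distance as a superposition of Gaussian kernels. -/

theorem one_sub_exp_neg_sq_nonneg (t : ℝ) : 0 ≤ 1 - Real.exp (-t ^ 2) := by
  rw [sub_nonneg, Real.exp_le_one_iff]
  nlinarith [sq_nonneg t]

/-- The integrand is at most `1` near zero and at most `a ^ 2 / r ^ 2` at infinity. -/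
theorem integrableOn_one_sub_exp_neg_sq_div (a : ℝ) :
    IntegrableOn (fun r : ℝ => 1 - Real.exp (-(a / r) ^ 2)) (Ioi 0) := by
  have hm : Measurable fun r : ℝ => 1 - Real.exp (-(a / r) ^ 2) := by fun_prop
  rw [← Ioc_union_Ioi_eq_Ioi (zero_le_one' ℝ)]
  refine IntegrableOn.union ?_ ?_
  · refine Integrable.of_bound hm.aestronglyMeasurable 1 (ae_of_all _ fun r => ?_)
    rw [Real.norm_of_nonneg (one_sub_exp_neg_sq_nonneg _)]
    linarith [Real.exp_pos (-(a / r) ^ 2)]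
  · have h1 : IntegrableOn (fun r : ℝ => a ^ 2 * r ^ (-2 : ℝ)) (Ioi 1) :=
      (integrableOn_Ioi_rpow_of_lt (by norm_num) one_pos).const_mul _
    refine Integrable.mono' h1 hm.aestronglyMeasurable ?_
    refine (ae_restrict_iff' measurableSet_Ioi).2 (ae_of_all _ fun r hr => ?_)
    have hr0 : (0 : ℝ) < r := one_pos.trans hr
    rw [Real.norm_of_nonneg (one_sub_exp_neg_sq_nonneg _), Real.rpow_neg hr0.le, Real.rpow_two,
      ← div_eq_mul_inv, ← div_pow]
    linarith [Real.add_one_le_exp (-(a / r) ^ 2)]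

/-- The substitution `r ↦ a * r` extracts the factor `a`; the constant is the integral at `a = 1`.
-/
theorem exists_integral_one_sub_exp_neg_sq_div :
    ∃ c : ℝ, 0 < c ∧ ∀ a : ℝ, 0 ≤ a → ∫ r in Ioi (0 : ℝ), (1 - Real.exp (-(a / r) ^ 2)) = c * a := by
  refine ⟨∫ r in Ioi (0 : ℝ), (1 - Real.exp (-(1 / r) ^ 2)), ?_, fun a ha => ?_⟩
  · rw [setIntegral_pos_iff_support_of_nonneg_ae (ae_of_all _ fun r => one_sub_exp_neg_sq_nonneg _)
      (integrableOn_one_sub_exp_neg_sq_div 1)]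
    have : Ioi (0 : ℝ) ⊆ Function.support (fun r : ℝ => 1 - Real.exp (-(1 / r) ^ 2)) ∩ Ioi 0 := by
      intro r hr
      refine ⟨?_, hr⟩
      have hr0 : (0 : ℝ) < r := hr
      have : Real.exp (-(1 / r) ^ 2) < 1 := by
        rw [Real.exp_lt_one_iff]
        have : 0 < (1 / r) ^ 2 := by positivity
        linarith
      rw [Function.mem_support]
      linarith
    refine lt_of_lt_of_le ?_ (measure_mono this)
    simp
  · rcases ha.eq_or_lt with rfl | ha
    · simp
    have h := integral_comp_mul_left_Ioi (fun r : ℝ => 1 - Real.exp (-(a / r) ^ 2)) 0 ha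
    rw [mul_zero, smul_eq_mul] at h
    have h2 : ∫ r in Ioi (0 : ℝ), (1 - Real.exp (-(a / (a * r)) ^ 2)) =
        ∫ r in Ioi (0 : ℝ), (1 - Real.exp (-(1 / r) ^ 2)) := by
      refine setIntegral_congr_fun measurableSet_Ioi fun r hr => ?_
      have hr0 : (0 : ℝ) < r := hr
      have : a / (a * r) = 1 / r := by field_simp
      simp only [this]
    rw [← h2, h]
    field_simp

/-- The Gaussian kernel at scale `r`. -/
noncomputable def gaussKernel {X : Type*} [Dist X] (r : ℝ) (x y : X) : ℝ :=
  Real.exp (-(dist x y / r) ^ 2)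

section

variable {X : Type*} [PseudoMetricSpace X]

theorem gaussKernel_pos (r : ℝ) (x y : X) : 0 < gaussKernel r x y := Real.exp_pos _

theorem gaussKernel_le_one (r : ℝ) (x y : X) : gaussKernel r x y ≤ 1 := by
  have := one_sub_exp_neg_sq_nonneg (dist x y / r)
  rw [gaussKernel]
  linarith

theorem abs_gaussKernel_le_one (r : ℝ) (x y : X) : |gaussKernel r x y| ≤ 1 := by
  rw [abs_of_pos (gaussKernel_pos r x y)]
  exact gaussKernel_le_one r x y

theorem continuous_gaussKernel (r : ℝ) :
    Continuous (Function.uncurry (gaussKernel (X := X) r)) := by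
  unfold gaussKernel Function.uncurry
  fun_prop

end

theorem dist_le_two {d : ℕ} (x y : UnitSphere d) : dist x y ≤ 2 := by
  rw [Subtype.dist_eq, dist_eq_norm]
  have := norm_sub_le (x : EuclideanSpace ℝ (Fin (d + 1))) y
  rw [norm_unitSphere, norm_unitSphere] at this
  linarith

theorem measurable_secondDiff {X : Type*} [MeasurableSpace X] {K : ℝ → X → X → ℝ}
    (hK : Measurable fun q : ℝ × (X × X) => K q.1 q.2.1 q.2.2) :
    Measurable fun q : ((X × X) × (X × X)) × ℝ => secondDiff (K q.2) q.1.1 q.1.2 := by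
  have h : ∀ {f g : ((X × X) × (X × X)) × ℝ → X}, Measurable f → Measurable g →
      Measurable fun q => K q.2 (f q) (g q) := fun hf hg =>
    hK.comp (measurable_snd.prodMk (hf.prodMk hg))
  unfold secondDiff
  exact (((h (by fun_prop) (by fun_prop)).sub (h (by fun_prop) (by fun_prop))).sub
    (h (by fun_prop) (by fun_prop))).add (h (by fun_prop) (by fun_prop))

/-- The second difference of the distance as a superposition of Gaussian second differences. -/
theorem integral_secondDiff_gaussKernel {X : Type*} [PseudoMetricSpace X]
    [SecondCountableTopology X] [MeasurableSpace X] [BorelSpace X]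
    (Q : Measure ((X × X) × (X × X))) [IsFiniteMeasure Q] {D : ℝ} (hD : ∀ x y : X, dist x y ≤ D)
    {c : ℝ} (hc : ∀ a : ℝ, 0 ≤ a → ∫ r in Ioi (0 : ℝ), (1 - Real.exp (-(a / r) ^ 2)) = c * a) :
    IntegrableOn (fun r => ∫ pq, secondDiff (gaussKernel r) pq.1 pq.2 ∂Q) (Ioi 0) ∧
    ∫ r in Ioi (0 : ℝ), ∫ pq, secondDiff (gaussKernel r) pq.1 pq.2 ∂Q =
      -c * ∫ pq, secondDiff dist pq.1 pq.2 ∂Q := by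
  have hi : ∀ x y : X, IntegrableOn (fun r => 1 - gaussKernel r x y) (Ioi 0) :=
    fun x y => integrableOn_one_sub_exp_neg_sq_div _
  have hpt : ∀ (pq : (X × X) × (X × X)),
      ∫ r in Ioi (0 : ℝ), secondDiff (gaussKernel r) pq.1 pq.2 =
        -c * secondDiff dist pq.1 pq.2 := by
    intro pq
    -- A second difference ignores constants, so the kernel may be replaced by `1 - gaussKernel`,
    -- which, unlike the kernel itself, is integrable in `r`.
    have h : ∀ r, secondDiff (gaussKernel r) pq.1 pq.2 =
        -((1 - gaussKernel r pq.1.1 pq.2.1) - (1 - gaussKernel r pq.1.1 pq.2.2) -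
          (1 - gaussKernel r pq.1.2 pq.2.1) + (1 - gaussKernel r pq.1.2 pq.2.2)) := by
      intro r
      rw [secondDiff]
      ring
    simp_rw [h]
    rw [integral_neg, integral_sub_sub_add (hi _ _) (hi _ _) (hi _ _) (hi _ _)]
    simp only [gaussKernel, hc _ dist_nonneg, secondDiff]
    ring
  have hk : Measurable fun q : ℝ × (X × X) => gaussKernel q.1 q.2.1 q.2.2 := by
    unfold gaussKernel
    fun_prop
  set f : (X × X) × (X × X) → ℝ → ℝ := fun pq r => secondDiff (gaussKernel r) pq.1 pq.2 with hf
  have hI : Integrable (Function.uncurry f) (Q.prod (volume.restrict (Ioi (0 : ℝ)))) := by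
    have h2 : Integrable (fun r : ℝ => 4 * (1 - Real.exp (-(D / r) ^ 2)))
        (volume.restrict (Ioi (0 : ℝ))) := (integrableOn_one_sub_exp_neg_sq_div D).const_mul 4
    refine (h2.comp_snd Q).mono' (measurable_secondDiff hk).aestronglyMeasurable
      (ae_of_all _ fun q => ?_)
    have hb : ∀ x y : X, 1 - gaussKernel q.2 x y ≤ 1 - Real.exp (-(D / q.2) ^ 2) := by
      intro x y
      have h3 : (dist x y / q.2) ^ 2 ≤ (D / q.2) ^ 2 := by
        rw [div_pow, div_pow]
        gcongr
        exact hD x y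
      have := Real.exp_le_exp.2 (neg_le_neg h3)
      rw [gaussKernel]
      linarith
    have hb' : ∀ x y : X, 0 ≤ 1 - gaussKernel q.2 x y := fun x y => one_sub_exp_neg_sq_nonneg _
    have h0 := one_sub_exp_neg_sq_nonneg (D / q.2)
    simp only [Function.uncurry, hf, secondDiff]
    rw [Real.norm_eq_abs, abs_le]
    constructor <;>
    linarith [hb q.1.1.1 q.1.2.1, hb q.1.1.1 q.1.2.2, hb q.1.1.2 q.1.2.1, hb q.1.1.2 q.1.2.2,
      hb' q.1.1.1 q.1.2.1, hb' q.1.1.1 q.1.2.2, hb' q.1.1.2 q.1.2.1, hb' q.1.1.2 q.1.2.2]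
  have hsw : ∫ r in Ioi (0 : ℝ), ∫ pq, f pq r ∂Q = -c * ∫ pq, secondDiff dist pq.1 pq.2 ∂Q := by
    rw [← integral_integral_swap hI, ← integral_const_mul]
    exact integral_congr_ae (ae_of_all _ hpt)
  exact ⟨hI.integral_prod_right, hsw⟩

/-- The cap discrepancy as a superposition of Gaussian energies. -/
theorem exists_integral_sq_sphericalCap_eq_gaussKernel (d : ℕ) :
    ∃ c : ℝ, 0 < c ∧ ∀ (ν : Measure (UnitSphere d)) [IsProbabilityMeasure ν],
      IntegrableOn (fun r => ∫ pq, secondDiff (gaussKernel r) pq.1 pq.2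
        ∂((ν.prod (uniformSphere d)).prod (ν.prod (uniformSphere d)))) (Ioi 0) ∧
      ∫ t in (-1 : ℝ)..1, ∫ x : UnitSphere d,
        (ν.real (sphericalCap x t) - (uniformSphere d).real (sphericalCap x t)) ^ 2
          ∂(uniformSphere d) =
      c * ∫ r in Ioi (0 : ℝ), ∫ pq, secondDiff (gaussKernel r) pq.1 pq.2
        ∂((ν.prod (uniformSphere d)).prod (ν.prod (uniformSphere d))) := by
  obtain ⟨c, hc, hcv⟩ := exists_integral_sq_sphericalCap_eq d
  obtain ⟨c', hc', hcv'⟩ := exists_integral_one_sub_exp_neg_sq_div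
  refine ⟨c / c', by positivity, fun ν _ => ?_⟩
  obtain ⟨h1, h2⟩ := integral_secondDiff_gaussKernel
    ((ν.prod (uniformSphere d)).prod (ν.prod (uniformSphere d))) dist_le_two hcv'
  refine ⟨h1, ?_⟩
  rw [hcv ν, h2]
  field_simp

/-! ### Positive definiteness of the Gaussian kernel. -/

section

variable {E : Type*} [NormedAddCommGroup E] [InnerProductSpace ℝ E] [FiniteDimensional ℝ E]
  [MeasurableSpace E] [BorelSpace E]

theorem integrable_exp_neg_mul_sq_norm {b : ℝ} (hb : 0 < b) :
    Integrable (fun v : E => Real.exp (-b * ‖v‖ ^ 2)) := by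
  refine Integrable.of_integral_ne_zero ?_
  rw [GaussianFourier.integral_rexp_neg_mul_sq_norm hb]
  positivity

/-- By the parallelogram law the product is a Gaussian in `w` centred at the midpoint of `x` and
`y`, times a Gaussian in `dist x y`. -/
theorem exists_integral_gauss_mul_gauss {b : ℝ} (hb : 0 < b) :
    ∃ c : ℝ, 0 < c ∧ ∀ x y : E,
      ∫ w, Real.exp (-(2 * b) * dist x w ^ 2) * Real.exp (-(2 * b) * dist y w ^ 2) =
        c * Real.exp (-b * dist x y ^ 2) := by
  refine ⟨∫ w : E, Real.exp (-(4 * b) * ‖w‖ ^ 2), ?_, fun x y => ?_⟩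
  · rw [GaussianFourier.integral_rexp_neg_mul_sq_norm (by positivity)]
    positivity
  · rw [← integral_sub_right_eq_self (fun w : E => Real.exp (-(4 * b) * ‖w‖ ^ 2))
      ((1 / 2 : ℝ) • (x + y)), ← integral_mul_const]
    refine integral_congr_ae (ae_of_all _ fun w => ?_)
    simp only
    rw [← Real.exp_add, ← Real.exp_add]
    congr 1
    have h := parallelogram_law_with_norm ℝ (x - w) (y - w)
    have h1 : x - w + (y - w) = -(2 : ℝ) • (w - (1 / 2 : ℝ) • (x + y)) := by
      module
    have h2 : x - w - (y - w) = x - y := by abel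
    rw [h1, h2, norm_smul, Real.norm_eq_abs, abs_neg, abs_two] at h
    rw [dist_eq_norm, dist_eq_norm, dist_eq_norm]
    linear_combination (b) * h

end

theorem integral_mul_self_add_nonneg {Ω : Type*} [MeasurableSpace Ω] {m : Measure Ω} {u v : Ω → ℝ}
    (huu : Integrable (fun w => u w * u w) m) (huv : Integrable (fun w => u w * v w) m)
    (hvv : Integrable (fun w => v w * v w) m) (l : ℝ) :
    0 ≤ ∫ w, u w * u w ∂m + 2 * l * ∫ w, u w * v w ∂m + l ^ 2 * ∫ w, v w * v w ∂m := by
  rw [← integral_const_mul, ← integral_const_mul, ← integral_add huu (huv.const_mul (2 * l)),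
    ← integral_add (f := fun w => u w * u w + 2 * l * (u w * v w)) (huu.add (huv.const_mul (2 * l)))
      (hvv.const_mul (l ^ 2))]
  refine integral_nonneg fun w => ?_
  have : u w * u w + 2 * l * (u w * v w) + l ^ 2 * (v w * v w) = (u w + l * v w) ^ 2 := by ring
  simp only [this]
  positivity

/-- Positive definiteness of the Gaussian kernel, in the form of a lower bound for the energy of a
difference of probability measures obtained by testing it against a finite measure. -/
theorem le_integral_secondDiff_gaussKernel {d : ℕ} (P : Measure (UnitSphere d × UnitSphere d))
    [IsProbabilityMeasure P] (β : Measure (UnitSphere d)) [IsFiniteMeasure β] {r : ℝ} (hr : 0 < r)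
    (l : ℝ) :
    2 * l * ∫ py, (gaussKernel r py.1.2 py.2 - gaussKernel r py.1.1 py.2) ∂(P.prod β) -
      l ^ 2 * ∫ p, gaussKernel r p.1 p.2 ∂(β.prod β) ≤
    ∫ pq, secondDiff (gaussKernel r) pq.1 pq.2 ∂(P.prod P) := by
  set b : ℝ := (r ^ 2)⁻¹ with hb
  have hbpos : 0 < b := by positivity
  obtain ⟨c, hc, hcv⟩ := exists_integral_gauss_mul_gauss (E := EuclideanSpace ℝ (Fin (d + 1))) hbpos
  -- `h` is a square root of the kernel: integrating `h x * h y` over the ambient space returns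
  -- `gaussKernel r x y` up to a constant.
  set h : UnitSphere d → EuclideanSpace ℝ (Fin (d + 1)) → ℝ := fun y w =>
    Real.exp (-(2 * b) * dist (y : EuclideanSpace ℝ (Fin (d + 1))) w ^ 2) with hh
  have hprod : ∀ x y : UnitSphere d, ∫ w, h x w * h y w = c * gaussKernel r x y := by
    intro x y
    rw [hh, hcv, gaussKernel, div_pow, Subtype.dist_eq, hb]
    congr 2
    field_simp
  have hmeas : Measurable (Function.uncurry h) := by
    refine Continuous.measurable ?_
    unfold Function.uncurry
    fun_prop
  have hmeas2 := measurable_uncurry_sub hmeas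
  have h0 : ∀ y w, 0 ≤ h y w := fun y w => (Real.exp_pos _).le
  have h1 : ∀ y w, h y w ≤ 1 := fun y w => by
    rw [Real.exp_le_one_iff]
    have : 0 ≤ 2 * b * dist (y : EuclideanSpace ℝ (Fin (d + 1))) w ^ 2 := by positivity
    linarith
  -- A majorant independent of `y`, obtained from `‖w‖ ^ 2 ≤ 2 + 2 * dist y w ^ 2`.
  set M : EuclideanSpace ℝ (Fin (d + 1)) → ℝ := fun w => Real.exp (2 * b) * Real.exp (-b * ‖w‖ ^ 2)
    with hMdef
  have hM : Integrable M := (integrable_exp_neg_mul_sq_norm hbpos).const_mul _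
  have hhM : ∀ y w, h y w ≤ M w := by
    intro y w
    rw [hMdef]
    simp only
    rw [← Real.exp_add]
    refine Real.exp_le_exp.2 ?_
    have h2 : ‖w‖ ≤ 1 + dist (y : EuclideanSpace ℝ (Fin (d + 1))) w := by
      have := norm_le_norm_add_norm_sub (y : EuclideanSpace ℝ (Fin (d + 1))) w
      rw [norm_unitSphere, ← dist_eq_norm] at this
      exact this
    have h3 : ‖w‖ ^ 2 ≤ 2 + 2 * dist (y : EuclideanSpace ℝ (Fin (d + 1))) w ^ 2 := by
      nlinarith [pow_le_pow_left₀ (norm_nonneg w) h2 2,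
        sq_nonneg (1 - dist (y : EuclideanSpace ℝ (Fin (d + 1))) w)]
    nlinarith [mul_le_mul_of_nonneg_left h3 hbpos.le]
  have hdM : ∀ (p : UnitSphere d × UnitSphere d) w, |h p.1 w - h p.2 w| ≤ M w := by
    intro p w
    rw [abs_le]
    constructor <;> linarith [h0 p.1 w, h0 p.2 w, hhM p.1 w, hhM p.2 w]
  have hd1 : ∀ (p : UnitSphere d × UnitSphere d) w, |h p.1 w - h p.2 w| ≤ 1 := by
    intro p w
    rw [abs_le]
    constructor <;> linarith [h0 p.1 w, h0 p.2 w, h1 p.1 w, h1 p.2 w]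
  have ha : ∀ y w, |h y w| = h y w := fun y w => abs_of_nonneg (h0 y w)
  obtain ⟨i1, e1⟩ := integral_mul_integral_eq (α := P) (β := P)
    (F := fun p w => h p.1 w - h p.2 w) (G := fun p w => h p.1 w - h p.2 w) hmeas2 hmeas2 hM
    hdM hd1
  obtain ⟨i2, e2⟩ := integral_mul_integral_eq (α := P) (β := β)
    (F := fun p w => h p.1 w - h p.2 w) (G := h) hmeas2 hmeas hM hdM
    (fun y w => (ha y w).trans_le (h1 y w))
  obtain ⟨i3, e3⟩ := integral_mul_integral_eq (α := β) (β := β) (F := h) (G := h) hmeas hmeas hM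
    (fun y w => (ha y w).trans_le (hhM y w)) (fun y w => (ha y w).trans_le (h1 y w))
  have hint : ∀ x y : UnitSphere d, Integrable fun w => h x w * h y w := by
    intro x y
    have hxm : Measurable (h x) := hmeas.of_uncurry_left
    have hym : Measurable (h y) := hmeas.of_uncurry_left
    refine hM.mono' (hxm.mul hym).aestronglyMeasurable
      (ae_of_all _ fun w => ?_)
    rw [Real.norm_of_nonneg (mul_nonneg (h0 _ _) (h0 _ _))]
    nlinarith [h0 x w, h0 y w, h1 y w, hhM x w]
  have k1 : ∀ p q : UnitSphere d × UnitSphere d,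
      ∫ w, (h p.1 w - h p.2 w) * (h q.1 w - h q.2 w) = c * secondDiff (gaussKernel r) p q := by
    intro p q
    have : ∀ w, (h p.1 w - h p.2 w) * (h q.1 w - h q.2 w) =
        h p.1 w * h q.1 w - h p.1 w * h q.2 w - h p.2 w * h q.1 w + h p.2 w * h q.2 w :=
      fun w => by ring
    simp_rw [this]
    rw [integral_sub_sub_add (hint _ _) (hint _ _) (hint _ _) (hint _ _), hprod, hprod, hprod, hprod,
      secondDiff]
    ring
  have k2 : ∀ (p : UnitSphere d × UnitSphere d) (y : UnitSphere d),
      ∫ w, (h p.1 w - h p.2 w) * h y w =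
        -c * (gaussKernel r p.2 y - gaussKernel r p.1 y) := by
    intro p y
    simp_rw [sub_mul]
    rw [integral_sub (hint _ _) (hint _ _), hprod, hprod]
    ring
  simp_rw [k1] at e1
  simp_rw [k2] at e2
  simp_rw [hprod] at e3
  rw [integral_const_mul] at e1 e2 e3
  -- The square expanded here is that of the average of `h p.1 - h p.2` over `P` plus `l` times the
  -- average of `h` over `β`.
  have hnn := integral_mul_self_add_nonneg i1 i2 i3 l
  rw [e1, e2, e3] at hnn
  refine le_of_mul_le_mul_left ?_ hc
  linarith

/-! ### Lower bounds for the Gaussian energy and the discrepancy. -/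

theorem integrable_gaussKernel_comp {X Y : Type*} [PseudoMetricSpace X]
    [SecondCountableTopology X] [MeasurableSpace X] [BorelSpace X] [MeasurableSpace Y]
    (μ : Measure Y) [IsFiniteMeasure μ] (r : ℝ) {f g : Y → X} (hf : Measurable f)
    (hg : Measurable g) : Integrable (fun y => gaussKernel r (f y) (g y)) μ :=
  Integrable.of_bound
    ((continuous_gaussKernel r).measurable.comp (hf.prodMk hg)).aestronglyMeasurable 1
    (ae_of_all _ fun _ => abs_gaussKernel_le_one _ _ _)

theorem integral_secondDiff_gaussKernel_nonneg {d : ℕ} (P : Measure (UnitSphere d × UnitSphere d))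
    [IsProbabilityMeasure P] {r : ℝ} (hr : 0 < r) :
    0 ≤ ∫ pq, secondDiff (gaussKernel r) pq.1 pq.2 ∂(P.prod P) := by
  simpa using le_integral_secondDiff_gaussKernel P (0 : Measure (UnitSphere d)) hr 0

theorem le_integral_gaussKernel {d : ℕ} {c : ℝ}
    (hc : ∀ (x : UnitSphere d) (r : ℝ), 0 < r → r ≤ 1 →
      c * r ^ d ≤ (uniformSphere d).real (Metric.ball x r)) (x : UnitSphere d) {r : ℝ} (hr : 0 < r)
    (hr1 : r ≤ 1) :
    Real.exp (-1) * (c * r ^ d) ≤ ∫ y, gaussKernel r y x ∂(uniformSphere d) := by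
  calc Real.exp (-1) * (c * r ^ d)
      ≤ Real.exp (-1) * (uniformSphere d).real (Metric.ball x r) := by
        gcongr
        exact hc x r hr hr1
    _ = ∫ y in Metric.ball x r, Real.exp (-1) ∂(uniformSphere d) := by
        rw [setIntegral_const, smul_eq_mul, mul_comm]
    _ ≤ ∫ y in Metric.ball x r, gaussKernel r y x ∂(uniformSphere d) := by
        refine setIntegral_mono_on (integrable_const _)
          (integrable_gaussKernel_comp _ r measurable_id measurable_const) measurableSet_ball
          fun y hy => Real.exp_le_exp.2 (neg_le_neg ?_)
        have h1 : dist y x / r ≤ 1 := (div_le_one hr).2 (Metric.mem_ball.1 hy).le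
        exact pow_le_one₀ (by positivity) h1
    _ ≤ _ := setIntegral_le_integral
          (integrable_gaussKernel_comp _ r measurable_id measurable_const)
          (ae_of_all _ fun y => (gaussKernel_pos r y x).le)

/-- Passing from scale `r` to `2 * r` keeps a quarter of the exponent for a kernel that still
integrates to order `r ^ d`. The other three quarters give the small factor, through `exp (-s) ≤ 1 /
s` at `s = 3 / (4 * δ ^ 2)`. -/
theorem gaussKernel_le_mul_of_le_dist {X : Type*} [PseudoMetricSpace X] {δ r : ℝ} (hδ : 0 < δ)
    (hr : 0 < r) {x y : X} (h : r ≤ δ * dist x y) :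
    gaussKernel r x y ≤ δ * (4 / 3) * δ * gaussKernel (2 * r) x y := by
  have h1 : 1 / δ ≤ dist x y / r := by
    rw [div_le_div_iff₀ hδ hr]
    linarith
  have h2 : (1 / δ) ^ 2 ≤ (dist x y / r) ^ 2 := pow_le_pow_left₀ (by positivity) h1 2
  have h3 : Real.exp (-(3 / 4 * (1 / δ) ^ 2)) ≤ δ * (4 / 3) * δ := by
    rw [Real.exp_neg, inv_le_comm₀ (Real.exp_pos _) (by positivity)]
    have := Real.add_one_le_exp (3 / 4 * (1 / δ) ^ 2)
    have h4 : (δ * (4 / 3) * δ)⁻¹ = 3 / 4 * (1 / δ) ^ 2 := by field_simp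
    linarith
  calc gaussKernel r x y ≤ Real.exp (-(3 / 4 * (1 / δ) ^ 2)) * gaussKernel (2 * r) x y := by
        rw [gaussKernel, gaussKernel, ← Real.exp_add]
        refine Real.exp_le_exp.2 ?_
        have h5 : dist x y / (2 * r) = dist x y / r / 2 := by field_simp
        rw [h5, div_pow (dist x y / r)]
        linarith
    _ ≤ _ := by
        gcongr
        exact (gaussKernel_pos _ _ _).le

/-- With `β` the restriction of `σ` to `Z`, the pairing of `σ` with `β` is at least `m * r ^ d`,
that of `ν` with `β` at most half of this by separation, and the self-energy of `β` at most `C * r ^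
d`. -/
theorem exists_le_gaussian_energy (d : ℕ) :
    ∃ δ κ : ℝ, 0 < δ ∧ δ ≤ 1 ∧ 0 < κ ∧ ∀ (ν : Measure (UnitSphere d)) [IsProbabilityMeasure ν]
      (Z : Set (UnitSphere d)) (ε r : ℝ), MeasurableSet Z → 1 / 2 ≤ (uniformSphere d).real Z →
      (∀ᵐ z ∂ν, ∀ y ∈ Z, ε ≤ dist z y) → 0 < r → r ≤ δ * ε → r ≤ 1 →
      κ * r ^ d ≤ ∫ pq, secondDiff (gaussKernel r) pq.1 pq.2
        ∂((ν.prod (uniformSphere d)).prod (ν.prod (uniformSphere d))) := by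
  obtain ⟨c, hc, hcv⟩ := exists_le_uniformSphere_ball d
  obtain ⟨C, hC, hCv⟩ := exists_integral_gaussian_le d
  -- The division by `2` is the lower bound for the mass of `Z`.
  set m : ℝ := Real.exp (-1) * c / 2 with hm
  have hmpos : 0 < m := by positivity
  set δ : ℝ := min 1 (3 * m / (8 * C * 2 ^ d)) with hδdef
  have hδ : 0 < δ := by positivity
  have hδ1 : δ ≤ 1 := min_le_left _ _
  have hδm : δ * (4 / 3) * δ * (C * 2 ^ d) ≤ m / 2 := by
    have h1 : δ ≤ 3 * m / (8 * C * 2 ^ d) := min_le_right _ _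
    rw [le_div_iff₀ (by positivity)] at h1
    calc δ * (4 / 3) * δ * (C * 2 ^ d) ≤ δ * (4 / 3) * 1 * (C * 2 ^ d) := by gcongr
      _ ≤ m / 2 := by linarith
  -- This is the maximum over `l` of `l * m - l ^ 2 * C`, attained at the value `l = m / (2 * C)`
  -- used below.
  refine ⟨δ, m ^ 2 / (4 * C), hδ, hδ1, by positivity, ?_⟩
  intro ν _ Z ε r hZ hZσ hsep hr hrδ hr1
  set σ := uniformSphere d with hσ
  set β := σ.restrict Z with hβ
  have hβ1 : β.real univ ≤ 1 := by
    rw [hβ, measureReal_restrict_apply_univ]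
    exact measureReal_le_one
  have hβ2 : 1 / 2 ≤ β.real univ := by
    rwa [hβ, measureReal_restrict_apply_univ]
  have hgm : ∀ {f g : (UnitSphere d × UnitSphere d) × UnitSphere d → UnitSphere d},
      Measurable f → Measurable g →
      Integrable (fun q => gaussKernel r (f q) (g q)) ((ν.prod σ).prod β) := fun hf hg =>
    integrable_gaussKernel_comp _ r hf hg
  have hup : ∀ z : UnitSphere d, ∫ y, gaussKernel r z y ∂σ ≤ C * r ^ d := fun z => hCv z r hr
  have hupβ : ∀ z : UnitSphere d, ∫ y, gaussKernel r z y ∂β ≤ C * r ^ d := fun z =>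
    (setIntegral_le_integral (integrable_gaussKernel_comp _ r measurable_const measurable_id)
      (ae_of_all _ fun y => (gaussKernel_pos r z y).le)).trans (hup z)
  have hS1 : m * r ^ d ≤ ∫ q, gaussKernel r q.1.2 q.2 ∂((ν.prod σ).prod β) := by
    rw [integral_prod _ (hgm (by fun_prop) (by fun_prop)),
      integral_fun_snd (fun z => ∫ y, gaussKernel r z y ∂β), probReal_univ, one_smul,
      integral_integral_swap (integrable_gaussKernel_comp _ r measurable_fst measurable_snd)]
    calc m * r ^ d = (1 / 2) * (Real.exp (-1) * (c * r ^ d)) := by rw [hm]; ring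
      _ ≤ β.real univ * (Real.exp (-1) * (c * r ^ d)) := by gcongr
      _ = ∫ y, Real.exp (-1) * (c * r ^ d) ∂β := by rw [integral_const, smul_eq_mul]
      _ ≤ _ := by
        refine integral_mono (integrable_const _) ?_ fun y => le_integral_gaussKernel hcv y hr hr1
        exact (integrable_gaussKernel_comp (σ.prod β) r measurable_fst
          measurable_snd).integral_prod_right
  have hS2 : ∫ q, gaussKernel r q.1.1 q.2 ∂((ν.prod σ).prod β) ≤ m / 2 * r ^ d := by
    rw [integral_prod _ (hgm (by fun_prop) (by fun_prop)),
      integral_fun_fst (fun z => ∫ y, gaussKernel r z y ∂β), probReal_univ, one_smul]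
    have hpt : ∀ᵐ z ∂ν, ∫ y, gaussKernel r z y ∂β ≤ m / 2 * r ^ d := by
      filter_upwards [hsep] with z hz
      calc ∫ y, gaussKernel r z y ∂β
          ≤ ∫ y in Z, δ * (4 / 3) * δ * gaussKernel (2 * r) z y ∂σ := by
            refine setIntegral_mono_on
              (integrable_gaussKernel_comp _ r measurable_const measurable_id)
              ((integrable_gaussKernel_comp _ _ measurable_const measurable_id).const_mul _) hZ
              fun y hy => gaussKernel_le_mul_of_le_dist hδ hr (hrδ.trans ?_)
            gcongr
            exact hz y hy
        _ ≤ ∫ y, δ * (4 / 3) * δ * gaussKernel (2 * r) z y ∂σ := by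
            refine setIntegral_le_integral
              ((integrable_gaussKernel_comp _ _ measurable_const measurable_id).const_mul _)
              (ae_of_all _ fun y => ?_)
            have := gaussKernel_pos (2 * r) z y
            simp only [Pi.zero_apply]
            positivity
        _ = δ * (4 / 3) * δ * ∫ y, gaussKernel (2 * r) z y ∂σ := integral_const_mul _ _
        _ ≤ δ * (4 / 3) * δ * (C * (2 * r) ^ d) := by
            gcongr
            exact hCv z (2 * r) (by positivity)
        _ = δ * (4 / 3) * δ * (C * 2 ^ d) * r ^ d := by rw [mul_pow]; ring
        _ ≤ m / 2 * r ^ d := by gcongr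
    calc _ ≤ ∫ z, m / 2 * r ^ d ∂ν := integral_mono_ae
          (integrable_gaussKernel_comp (ν.prod β) r measurable_fst
            measurable_snd).integral_prod_left (integrable_const _) hpt
      _ = m / 2 * r ^ d := by simp
  have hT : ∫ p, gaussKernel r p.1 p.2 ∂(β.prod β) ≤ C * r ^ d := by
    have hi := integrable_gaussKernel_comp (β.prod β) r measurable_fst measurable_snd
    rw [integral_prod _ hi]
    calc _ ≤ ∫ z, C * r ^ d ∂β := integral_mono hi.integral_prod_left (integrable_const _) hupβ
      _ = β.real univ * (C * r ^ d) := by rw [integral_const, smul_eq_mul]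
      _ ≤ 1 * (C * r ^ d) := by gcongr
      _ = C * r ^ d := one_mul _
  refine le_trans ?_ (le_integral_secondDiff_gaussKernel (ν.prod σ) β hr (m / (2 * C)))
  rw [integral_sub (hgm (by fun_prop) (by fun_prop)) (hgm (by fun_prop) (by fun_prop))]
  calc m ^ 2 / (4 * C) * r ^ d
      = 2 * (m / (2 * C)) * (m * r ^ d - m / 2 * r ^ d) - (m / (2 * C)) ^ 2 * (C * r ^ d) := by
        field_simp
        ring
    _ ≤ _ := by gcongr

/-- If the complement of the `ε`-neighbourhood of a set of full `ν`-measure has uniform measure at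
least `1/2`, then the squared cap discrepancy of `ν` is at least of order `ε ^ (d + 1)`. -/
theorem exists_le_integral_sq_sphericalCap (d : ℕ) :
    ∃ κ : ℝ, 0 < κ ∧ ∀ (ν : Measure (UnitSphere d)) [IsProbabilityMeasure ν]
      (Z : Set (UnitSphere d)) (ε : ℝ), MeasurableSet Z → 1 / 2 ≤ (uniformSphere d).real Z →
      (∀ᵐ z ∂ν, ∀ y ∈ Z, ε ≤ dist z y) → 0 < ε → ε ≤ 1 →
      κ * ε ^ (d + 1) ≤ ∫ t in (-1 : ℝ)..1, ∫ x : UnitSphere d,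
        (ν.real (sphericalCap x t) - (uniformSphere d).real (sphericalCap x t)) ^ 2
          ∂(uniformSphere d) := by
  obtain ⟨c, hc, hcv⟩ := exists_integral_sq_sphericalCap_eq_gaussKernel d
  obtain ⟨δ, κ, hδ, hδ1, hκ, hκv⟩ := exists_le_gaussian_energy d
  refine ⟨c * (δ / 2 * (κ * (δ / 2) ^ d)), by positivity, fun ν _ Z ε hZ hZσ hsep hε hε1 => ?_⟩
  obtain ⟨hI, hE⟩ := hcv ν
  rw [hE, mul_assoc]
  gcongr
  have hδε : δ * ε ≤ 1 := mul_le_one₀ hδ1 hε.le hε1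
  have hsub : Ioc (δ * ε / 2) (δ * ε) ⊆ Ioi 0 := fun r hr =>
    (by positivity : 0 < δ * ε / 2).trans hr.1
  -- An interval of length `δ * ε / 2` supplies the extra power of `ε`; the other scales are dropped
  -- by nonnegativity.
  calc δ / 2 * (κ * (δ / 2) ^ d) * ε ^ (d + 1)
      = ∫ r in Ioc (δ * ε / 2) (δ * ε), κ * (δ * ε / 2) ^ d := by
        rw [setIntegral_const, Real.volume_real_Ioc_of_le (by linarith [mul_pos hδ hε]),
          smul_eq_mul, pow_succ, show δ * ε / 2 = δ / 2 * ε by ring, mul_pow]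
        ring
    _ ≤ ∫ r in Ioc (δ * ε / 2) (δ * ε), ∫ pq, secondDiff (gaussKernel r) pq.1 pq.2
          ∂((ν.prod (uniformSphere d)).prod (ν.prod (uniformSphere d))) := by
        refine setIntegral_mono_on (integrable_const _) (hI.mono_set hsub) measurableSet_Ioc
          fun r hr => ?_
        refine le_trans ?_ (hκv ν Z ε r hZ hZσ hsep (hsub hr) hr.2 (hr.2.trans hδε))
        have := hr.1.le
        gcongr
    _ ≤ _ := setIntegral_mono_set hI
        ((ae_restrict_iff' measurableSet_Ioi).2 (ae_of_all _ fun r hr =>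
          integral_secondDiff_gaussKernel_nonneg _ hr)) hsub.eventuallyLE

/-! ### From packing numbers to discrepancy. -/

/-- A maximal separated subset is a net. -/
theorem exists_finset_subset_iUnion_closedBall {X : Type*} [PseudoMetricSpace X] {s : Set X}
    {ε N : ℝ} (hε : 0 ≤ ε) (h : ∀ T : Finset X, (T : Set X) ⊆ s →
      (T : Set X).Pairwise (fun x y => ε < dist x y) → (T.card : ℝ) ≤ N) :
    ∃ T : Finset X, (T.card : ℝ) ≤ N ∧ s ⊆ ⋃ p ∈ T, Metric.closedBall p ε := by
  classical
  set A : Set ℕ := {n | ∃ T : Finset X, (T : Set X) ⊆ s ∧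
    (T : Set X).Pairwise (fun x y => ε < dist x y) ∧ T.card = n} with hA
  have hne : A.Nonempty := ⟨0, ∅, by simp, by simp, rfl⟩
  have hbdd : BddAbove A := by
    refine ⟨⌊N⌋₊, ?_⟩
    rintro n ⟨T, h1, h2, rfl⟩
    exact Nat.le_floor (h T h1 h2)
  obtain ⟨T, hTs, hTp, hTc⟩ := Nat.sSup_mem hne hbdd
  refine ⟨T, h T hTs hTp, fun x hx => ?_⟩
  by_contra hcon
  simp only [mem_iUnion, Metric.mem_closedBall, not_exists, not_le] at hcon
  have hxT : x ∉ T := fun hxT => by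
    have := hcon x hxT
    rw [dist_self] at this
    linarith
  have hins : (insert x T).card ∈ A := by
    refine ⟨insert x T, ?_, ?_, rfl⟩
    · rw [Finset.coe_insert]
      exact insert_subset hx hTs
    · rw [Finset.coe_insert]
      refine hTp.insert fun y hy _ => ⟨hcon y hy, ?_⟩
      rw [dist_comm]
      exact hcon y hy
  have := le_csSup hbdd hins
  rw [← hTc, Finset.card_insert_of_notMem hxT] at this
  omega

theorem exists_uniformSphere_closedBall_le (d : ℕ) :
    ∃ C : ℝ, 0 < C ∧ ∀ (x : UnitSphere d) (r : ℝ), 0 < r →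
      (uniformSphere d).real (Metric.closedBall x r) ≤ C * r ^ d := by
  obtain ⟨C, hC, h⟩ := exists_integral_gaussian_le d
  refine ⟨C * Real.exp 1, by positivity, fun x r hr => ?_⟩
  have h1 : Real.exp (-1) * (uniformSphere d).real (Metric.closedBall x r) ≤ C * r ^ d := by
    refine le_trans ?_ (h x r hr)
    have hi : Integrable (fun y => gaussKernel r x y) (uniformSphere d) :=
      integrable_gaussKernel_comp _ r measurable_const measurable_id
    calc _ = ∫ y in Metric.closedBall x r, Real.exp (-1) ∂(uniformSphere d) := by
          rw [setIntegral_const, smul_eq_mul, mul_comm]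
      _ ≤ ∫ y in Metric.closedBall x r, gaussKernel r x y ∂(uniformSphere d) := by
          refine setIntegral_mono_on (integrable_const _) hi.integrableOn
            Metric.isClosed_closedBall.measurableSet fun y hy => Real.exp_le_exp.2 (neg_le_neg ?_)
          have h1 : dist x y / r ≤ 1 := (div_le_one hr).2 (by rw [dist_comm]; exact hy)
          exact pow_le_one₀ (by positivity) h1
      _ ≤ _ := setIntegral_le_integral hi (ae_of_all _ fun y => (gaussKernel_pos r x y).le)
  rw [Real.exp_neg, inv_mul_le_iff₀ (Real.exp_pos 1)] at h1
  linarith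

/-- Probability measures carried by sets with small packing numbers have large cap discrepancy. -/
theorem exists_le_integral_sq_of_packing (d : ℕ) (hd : 2 ≤ d) :
    ∃ κ : ℝ, 0 < κ ∧ ∀ (ν : Measure (UnitSphere d)) [IsProbabilityMeasure ν]
      (s : Set (UnitSphere d)) (L : ℝ), (∀ᵐ z ∂ν, z ∈ s) → 1 ≤ L →
      (∀ (ε : ℝ) (T : Finset (UnitSphere d)), 0 < ε → ε ≤ 1 → (T : Set (UnitSphere d)) ⊆ s →
        (T : Set (UnitSphere d)).Pairwise (fun x y => ε < dist x y) →
          (T.card : ℝ) ≤ 3 * L / ε) →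
      κ * L ^ (-(((d : ℝ) + 1) / ((d : ℝ) - 1))) ≤ ∫ t in (-1 : ℝ)..1, ∫ x : UnitSphere d,
        (ν.real (sphericalCap x t) - (uniformSphere d).real (sphericalCap x t)) ^ 2
          ∂(uniformSphere d) := by
  obtain ⟨κ, hκ, hκv⟩ := exists_le_integral_sq_sphericalCap d
  obtain ⟨C, hC, hCv⟩ := exists_uniformSphere_closedBall_le d
  -- At most `3 * L / ε` balls of measure at most `C * (2 * ε) ^ d` cover total measure at most `3 *
  -- C * 2 ^ d * η` once `ε ^ (d - 1) = η / L`; this `η` makes that at most `1 / 2`.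
  set η : ℝ := min 1 (1 / (6 * (C * 2 ^ d))) with hη
  have hη0 : 0 < η := by positivity
  have hη1 : η ≤ 1 := min_le_left _ _
  have hηC : 3 * (C * 2 ^ d) * η ≤ 1 / 2 := by
    have := min_le_right 1 (1 / (6 * (C * 2 ^ d)))
    rw [← hη, le_div_iff₀ (by positivity)] at this
    linarith
  have hd2 : (2 : ℝ) ≤ d := by exact_mod_cast hd
  have hd1 : (0 : ℝ) < (d : ℝ) - 1 := by linarith
  refine ⟨κ * η ^ (((d : ℝ) + 1) / ((d : ℝ) - 1)), by positivity, fun ν _ s L hν hL hpack => ?_⟩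
  have hL0 : 0 < L := by linarith
  set ε : ℝ := (η / L) ^ (1 / ((d : ℝ) - 1)) with hε
  have hε0 : 0 < ε := by positivity
  have hε1 : ε ≤ 1 := Real.rpow_le_one (by positivity) ((div_le_one hL0).2 (hη1.trans hL))
    (by positivity)
  have hεd : ε ^ (d - 1) = η / L := by
    rw [hε, ← Real.rpow_natCast, ← Real.rpow_mul (by positivity), Nat.cast_sub (by omega),
      Nat.cast_one, one_div, inv_mul_cancel₀ hd1.ne', Real.rpow_one]
  have hεd1 : ε ^ (d + 1) = η ^ (((d : ℝ) + 1) / ((d : ℝ) - 1)) *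
      L ^ (-(((d : ℝ) + 1) / ((d : ℝ) - 1))) := by
    rw [hε, ← Real.rpow_natCast, ← Real.rpow_mul (by positivity), Nat.cast_add, Nat.cast_one,
      one_div_mul_eq_div, Real.div_rpow hη0.le hL0.le, Real.rpow_neg hL0.le, div_eq_mul_inv]
  rw [mul_assoc, ← hεd1]
  obtain ⟨T, hTc, hTs⟩ := exists_finset_subset_iUnion_closedBall hε0.le
    fun T h1 h2 => hpack ε T hε0 hε1 h1 h2
  -- The doubled radius keeps every point outside `U` at distance at least `ε` from `s`, not just
  -- from the net.
  set U : Set (UnitSphere d) := ⋃ p ∈ T, Metric.closedBall p (2 * ε) with hU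
  have hUm : MeasurableSet U :=
    T.measurableSet_biUnion fun p _ => Metric.isClosed_closedBall.measurableSet
  have hUσ : (uniformSphere d).real U ≤ 1 / 2 := by
    calc (uniformSphere d).real U
        ≤ ∑ p ∈ T, (uniformSphere d).real (Metric.closedBall p (2 * ε)) :=
          measureReal_biUnion_finset_le _ _
      _ ≤ ∑ p ∈ T, C * (2 * ε) ^ d :=
          Finset.sum_le_sum fun p _ => hCv p (2 * ε) (by positivity)
      _ = T.card * (C * (2 * ε) ^ d) := by rw [Finset.sum_const, nsmul_eq_mul]
      _ ≤ 3 * L / ε * (C * (2 * ε) ^ d) := by gcongr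
      _ = 3 * (C * 2 ^ d) * (L * ε ^ (d - 1)) := by
          have : ε ^ d = ε ^ (d - 1) * ε := by rw [← pow_succ, Nat.sub_add_cancel (by omega)]
          rw [mul_pow, this]
          field_simp
      _ = 3 * (C * 2 ^ d) * η := by rw [hεd, mul_div_cancel₀ _ hL0.ne']
      _ ≤ 1 / 2 := hηC
  refine hκv ν Uᶜ ε hUm.compl ?_ ?_ hε0 hε1
  · rw [probReal_compl_eq_one_sub hUm]
    linarith
  · filter_upwards [hν] with z hz y hy
    obtain ⟨p, hp, hzp⟩ := mem_iUnion₂.1 (hTs hz)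
    have hyp : 2 * ε < dist y p := by
      by_contra hcon
      exact hy (mem_iUnion₂.2 ⟨p, hp, not_lt.1 hcon⟩)
    have := dist_triangle y z p
    rw [dist_comm y z] at this
    linarith [Metric.mem_closedBall.1 hzp]

/-! ### Hausdorff measure and packing numbers of curves. -/

/-- The distance to `p` is 1-Lipschitz and, by connectedness, takes every value in `[0, r)` on the
part of `s` inside the ball. -/
theorem le_hausdorffMeasure_inter_ball {X : Type*} [MetricSpace X] [MeasurableSpace X]
    [BorelSpace X] {s : Set X} (hs : IsPreconnected s) {p q : X} (hp : p ∈ s) (hq : q ∈ s) {r : ℝ}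
    (hr : r ≤ dist q p) : ENNReal.ofReal r ≤ μH[1] (s ∩ Metric.ball p r) := by
  have hsub : Ico 0 r ⊆ (fun x => dist x p) '' (s ∩ Metric.ball p r) := by
    intro t ht
    have hI := hs.intermediate_value hp hq (f := fun x => dist x p) (by fun_prop)
    obtain ⟨x, hx, hxt⟩ := hI ⟨by simpa using ht.1, ht.2.le.trans hr⟩
    refine ⟨x, ⟨hx, ?_⟩, hxt⟩
    rw [Metric.mem_ball]
    exact lt_of_eq_of_lt hxt ht.2
  calc ENNReal.ofReal r = μH[1] (Ico 0 r) := by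
        rw [hausdorffMeasure_real, Real.volume_Ico, sub_zero]
    _ ≤ μH[1] ((fun x => dist x p) '' (s ∩ Metric.ball p r)) := measure_mono hsub
    _ ≤ μH[1] (s ∩ Metric.ball p r) := by
        simpa using (LipschitzWith.dist_left p).hausdorffMeasure_image_le zero_le_one
          (s ∩ Metric.ball p r)

/-- Balls of radius `ε / 2` about the points of `T` are disjoint, and each contains measure at least
`ε / 2` of `s`, since another point of `T` lies outside it. The summand `1` covers the case where
there is no other point. -/
theorem card_le_of_pairwise_lt_dist {X : Type*} [MetricSpace X] [MeasurableSpace X]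
    [BorelSpace X] {s : Set X} (hs : IsPreconnected s) (hsm : MeasurableSet s)
    (hfin : μH[1] s ≠ ∞) {ε : ℝ} (hε : 0 < ε) {T : Finset X} (hT : (T : Set X) ⊆ s)
    (hTp : (T : Set X).Pairwise fun x y => ε < dist x y) :
    (T.card : ℝ) ≤ 1 + 2 * (μH[1]).real s / ε := by
  have h0 : 0 ≤ 2 * (μH[1]).real s / ε := by positivity
  rcases le_or_gt T.card 1 with hc | hc
  · have : (T.card : ℝ) ≤ 1 := by exact_mod_cast hc
    linarith
  have hball : ∀ p ∈ T, ENNReal.ofReal (ε / 2) ≤ μH[1] (s ∩ Metric.ball p (ε / 2)) := by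
    intro p hp
    obtain ⟨q, hq, hqp⟩ := Finset.exists_mem_ne hc p
    exact le_hausdorffMeasure_inter_ball hs (hT hp) (hT hq) (by linarith [hTp hq hp hqp])
  have hdisj : (T : Set X).PairwiseDisjoint fun p => s ∩ Metric.ball p (ε / 2) := by
    intro p hp q hq hpq
    refine (Metric.ball_disjoint_ball ?_).mono inter_subset_right inter_subset_right
    linarith [hTp hp hq hpq]
  have hsum : (T.card : ℝ≥0∞) * ENNReal.ofReal (ε / 2) ≤ μH[1] s := by
    calc (T.card : ℝ≥0∞) * ENNReal.ofReal (ε / 2) = ∑ p ∈ T, ENNReal.ofReal (ε / 2) := by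
          rw [Finset.sum_const, nsmul_eq_mul]
      _ ≤ ∑ p ∈ T, μH[1] (s ∩ Metric.ball p (ε / 2)) := Finset.sum_le_sum hball
      _ = μH[1] (⋃ p ∈ T, s ∩ Metric.ball p (ε / 2)) :=
          (measure_biUnion_finset hdisj fun p _ => hsm.inter measurableSet_ball).symm
      _ ≤ μH[1] s := measure_mono (iUnion₂_subset fun p _ => inter_subset_left)
  have hreal := ENNReal.toReal_mono hfin hsum
  rw [ENNReal.toReal_mul, ENNReal.toReal_natCast, ENNReal.toReal_ofReal (by positivity)] at hreal
  have : (T.card : ℝ) ≤ 2 * (μH[1]).real s / ε := by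
    rw [le_div_iff₀ hε, measureReal_def]
    linarith
  linarith

/-- The one-dimensional Hausdorff measure of a curve is at most its length. -/
theorem hausdorffMeasure_image_le_eVariationOn {X : Type*} [MetricSpace X] [MeasurableSpace X]
    [BorelSpace X] {γ : ℝ → X} {a b : ℝ} (hab : a ≤ b) (hγ : BoundedVariationOn γ (Icc a b)) :
    μH[1] (γ '' Icc a b) ≤ eVariationOn γ (Icc a b) := by
  have hloc := hγ.locallyBoundedVariationOn
  have ha : a ∈ Icc a b := left_mem_Icc.2 hab
  set v := variationOnFromTo γ (Icc a b) a with hv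
  set g := naturalParameterization γ (Icc a b) a with hg
  have hsub : γ '' Icc a b ⊆ g '' (v '' Icc a b) := by
    rintro _ ⟨t, ht, rfl⟩
    exact ⟨v t, mem_image_of_mem v ht,
      edist_eq_zero.1 (edist_naturalParameterization_eq_zero hloc ha ht)⟩
  have hspeed : HasUnitSpeedOn g (v '' Icc a b) := has_unit_speed_naturalParameterization γ hloc ha
  -- Unit speed bounds distances by parameter differences, so the curve is a 1-Lipschitz image of a
  -- subset of an interval as long as its variation.
  have hlip : LipschitzOnWith 1 g (v '' Icc a b) := by
    intro x hx y hy
    wlog hxy : x ≤ y generalizing x y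
    · rw [edist_comm, edist_comm x y]
      exact this hy hx (le_of_not_ge hxy)
    calc edist (g x) (g y) ≤ eVariationOn g (v '' Icc a b ∩ Icc x y) :=
          eVariationOn.edist_le g ⟨hx, left_mem_Icc.2 hxy⟩ ⟨hy, right_mem_Icc.2 hxy⟩
      _ = ENNReal.ofReal (y - x) := by
          have := hspeed hx hy
          simpa using this
      _ = _ := by
          rw [edist_comm, edist_dist, Real.dist_eq, abs_of_nonneg (sub_nonneg.2 hxy)]
          simp
  have hvsub : v '' Icc a b ⊆ Icc 0 (eVariationOn γ (Icc a b)).toReal := by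
    rintro _ ⟨t, ht, rfl⟩
    rw [hv, variationOnFromTo.eq_of_le _ _ ht.1]
    exact ⟨ENNReal.toReal_nonneg, ENNReal.toReal_mono hγ (eVariationOn.mono _ inter_subset_left)⟩
  calc μH[1] (γ '' Icc a b) ≤ μH[1] (g '' (v '' Icc a b)) := measure_mono hsub
    _ ≤ μH[1] (v '' Icc a b) := by
        simpa using hlip.hausdorffMeasure_image_le zero_le_one
    _ ≤ μH[1] (Icc 0 (eVariationOn γ (Icc a b)).toReal) := measure_mono hvsub
    _ = eVariationOn γ (Icc a b) := by
        rw [hausdorffMeasure_real, Real.volume_Icc, sub_zero, ENNReal.ofReal_toReal hγ]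

theorem hausdorffMeasure_image_pos {X : Type*} [MetricSpace X] [MeasurableSpace X]
    [BorelSpace X] {γ : ℝ → X} {a b : ℝ} (hγ : ContinuousOn γ (Icc a b))
    (hlen : eVariationOn γ (Icc a b) ≠ 0) : 0 < μH[1] (γ '' Icc a b) := by
  have hns : ¬(γ '' Icc a b).Subsingleton := fun h => hlen (eVariationOn.constant_on h)
  obtain ⟨p, hp, q, hq, hpq⟩ := not_subsingleton_iff.1 hns
  have h := le_hausdorffMeasure_inter_ball (isPreconnected_Icc.image γ hγ) hq hp le_rfl
  exact (ENNReal.ofReal_pos.2 (dist_pos.2 hpq)).trans_le (h.trans (measure_mono inter_subset_left))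

/-! ### The discrepancy of a rectifiable curve. -/

theorem capDiscrepancy_eq_sqrt_cond {d : ℕ} {s : ℝ} {X : Set (UnitSphere d)}
    (hX : MeasurableSet X) :
    capDiscrepancy s X = Real.sqrt (∫ t in (-1 : ℝ)..1, ∫ x : UnitSphere d,
      ((ProbabilityTheory.cond μH[s] X).real (sphericalCap x t) -
        (uniformSphere d).real (sphericalCap x t)) ^ 2 ∂(uniformSphere d)) := by
  have h : ∀ t (x : UnitSphere d), (ProbabilityTheory.cond μH[s] X).real (sphericalCap x t) =
      (μH[s]).real (X ∩ sphericalCap x t) / (μH[s]).real X := by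
    intro t x
    rw [measureReal_def, ProbabilityTheory.cond_apply hX, ENNReal.toReal_mul, ENNReal.toReal_inv,
      ← div_eq_inv_mul]
    rfl
  simp_rw [capDiscrepancy, sq_abs, h]

/-- Only an upper bound `L` for the Hausdorff measure is needed, so leaving `L` free serves both
readings of length with one constant. -/
theorem exists_le_capDiscrepancy_curve (d : ℕ) (hd : 2 ≤ d) :
    ∃ c : ℝ, 0 < c ∧ ∀ (γ : ℝ → UnitSphere d) (a b : ℝ), IsRectifiableCurve γ a b →
      μH[1] (γ '' Icc a b) ≠ 0 → ∀ L : ℝ, 1 ≤ L → (μH[1]).real (γ '' Icc a b) ≤ L →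
      c * L ^ (-(((d : ℝ) + 1) / (2 * ((d : ℝ) - 1)))) ≤ capDiscrepancy 1 (γ '' Icc a b) := by
  obtain ⟨κ, hκ, hκv⟩ := exists_le_integral_sq_of_packing d hd
  refine ⟨Real.sqrt κ, Real.sqrt_pos.2 hκ, fun γ a b hγ hpos L hL hHL => ?_⟩
  have hL0 : 0 < L := by linarith
  have hcpt : IsCompact (γ '' Icc a b) := isCompact_Icc.image_of_continuousOn hγ.continuousOn
  have hm : MeasurableSet (γ '' Icc a b) := hcpt.isClosed.measurableSet
  have hconn : IsPreconnected (γ '' Icc a b) := isPreconnected_Icc.image γ hγ.continuousOn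
  have hfin : μH[1] (γ '' Icc a b) ≠ ∞ :=
    ne_top_of_le_ne_top hγ.boundedVariationOn
      (hausdorffMeasure_image_le_eVariationOn hγ.le hγ.boundedVariationOn)
  have hprob : IsProbabilityMeasure (ProbabilityTheory.cond μH[1] (γ '' Icc a b)) :=
    ProbabilityTheory.cond_isProbabilityMeasure_of_finite hpos hfin
  have h := hκv (ProbabilityTheory.cond μH[1] (γ '' Icc a b)) (γ '' Icc a b) L
    (ProbabilityTheory.ae_cond_mem hm) hL fun ε T hε hε1 hT hTp => by
      refine (card_le_of_pairwise_lt_dist hconn hm hfin hε hT hTp).trans ?_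
      -- The summand `1` of the packing bound is absorbed into `L / ε`, whence the factor `3`.
      have h1 : 1 ≤ L / ε := (one_le_div hε).2 (hε1.trans hL)
      have h2 : 2 * (μH[1]).real (γ '' Icc a b) / ε ≤ 2 * L / ε := by gcongr
      have h3 : 3 * L / ε = L / ε + 2 * L / ε := by ring
      linarith
  rw [capDiscrepancy_eq_sqrt_cond hm]
  refine le_trans (le_of_eq ?_) (Real.sqrt_le_sqrt h)
  rw [Real.sqrt_mul hκ.le, Real.sqrt_eq_rpow (L ^ _), ← Real.rpow_mul hL0.le]
  congr 2
  rw [mul_comm 2, ← div_div]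
  ring

theorem mainTheorem10 (d : ℕ) (hd : 2 ≤ d) :
    ∃ c : ℝ, 0 < c ∧ ∀ (γ : ℝ → UnitSphere d) (a b : ℝ), IsRectifiableCurve γ a b →
      (1 ≤ (μH[1]).real (γ '' Icc a b) →
        c * (μH[1]).real (γ '' Icc a b) ^ (-(((d : ℝ) + 1) / (2 * ((d : ℝ) - 1))))
          ≤ capDiscrepancy 1 (γ '' Icc a b)) ∧
      (1 ≤ arcLength γ a b →
        c * arcLength γ a b ^ (-(((d : ℝ) + 1) / (2 * ((d : ℝ) - 1))))
          ≤ capDiscrepancy 1 (γ '' Icc a b)) := by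
  obtain ⟨c, hc, h⟩ := exists_le_capDiscrepancy_curve d hd
  refine ⟨c, hc, fun γ a b hγ => ⟨fun h1 => h γ a b hγ ?_ _ h1 le_rfl, fun h1 => ?_⟩⟩
  · intro h0
    rw [measureReal_def, h0, ENNReal.toReal_zero] at h1
    linarith
  · have hlen : eVariationOn γ (Icc a b) ≠ 0 := by
      intro h0
      rw [arcLength, h0, ENNReal.toReal_zero] at h1
      linarith
    exact h γ a b hγ (hausdorffMeasure_image_pos hγ.continuousOn hlen).ne' _ h1
      (ENNReal.toReal_mono hγ.boundedVariationOn
        (hausdorffMeasure_image_le_eVariationOn hγ.le hγ.boundedVariationOn))
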